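/- For a graph $G$ on $n$ vertices with adjacency matrix $A$ and a vertex $x$, let $w_k(x)=(A^k\mathbf 1)_x$, where $\mathbf 1$ is the all-ones vector; this is the number of walks of length $k$ in $G$ starting from $x$. Algorithm A takes the adjacency matrix of $G$ as input, forms the vector $D_1$ of vertex degrees, and computes $D_2=AD_1$ and $D_3=AD_2$. Let $W$ be the matrix with columns $D_1,D_2,D_3$, so that its row of $x$ is $W_x=(w_1(x),w_2(x),w_3(x))$. If $W_x=W_y$ for some $x\neq y$, the algorithm gives up; otherwise it assigns to each vertex $x$ the label $W_x$. An algorithm canonizes $G$ if on input $G$ it assigns pairwise different labels to the vertices and, for every isomorphism $\alpha$ from $G$ to a graph $H$ on the same vertex set, on input $H$ it assigns to each vertex $\alpha(x)$ the label that it assigns to $x$ on input $G$. Corollary. Algorithm A canonizes the random graph $G(n,1/2)$ with probability tending to $1$ as $n\to\infty$. On every $n$-vertex input graph it halts with the result described above, in time $O(n^2)$ if every arithmetic operation, comparison and memory access takes one step, and in time $O(n^2\log n\log\log n)$ if every operation is charged the bit lengths of the numbers and addresses involved and the multiplication of two $\ell$-bit integers is charged $O(\ell\log \ell)$ for $\ell\ge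 2$ (and $O(1)$ for $\ell=1$). -/

import Mathlib

/-! ### A random access machine language with step counts

Structured programs over finitely many named registers and finitely many named arrays; every
register and every array cell holds a natural number. A run has a cost in `ℕ × ℕ`:
* the first component counts elementary operations (uniform cost: every arithmetic operation,
  comparison, memory access and assignment counts as one step);
* the second component counts bit operations (logarithmic cost: every operation is charged the bit
  lengths of the numbers and addresses involved; the product of two numbers of at most `ℓ` bits is
  charged `ℓ (⌊log₂ ℓ⌋ + 1)`). -/

namespace RAM

/-- The number of binary digits of `a` (one digit for `a = 0`). -/
def bitLen (a : ℕ) : ℕ := Nat.log 2 a + 1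

/-- The bit cost of multiplying `a` and `b`. -/
def mulBits (a b : ℕ) : ℕ :=
  max (bitLen a) (bitLen b) * (Nat.log 2 (max (bitLen a) (bitLen b)) + 1)

/-- Names of registers. -/
inductive Reg
  | size | x | y | acc | dup | success
  deriving DecidableEq

/-- Names of arrays. -/
inductive Arr
  | adj | D1 | D2 | D3 | label
  deriving DecidableEq

/-- A memory state. -/
structure State where
  reg : Reg → ℕ
  arr : Arr → ℕ → ℕ

/-- The state `s` with the value `a` written to the register `r`. -/
def State.setReg (s : State) (r : Reg) (a : ℕ) : State where
  reg := Function.update s.reg r a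
  arr := s.arr

/-- The state `s` with the value `a` written to the `i`-th cell of the array `b`. -/
def State.setArr (s : State) (b : Arr) (i a : ℕ) : State where
  reg := s.reg
  arr := Function.update s.arr b (Function.update (s.arr b) i a)

/-- Arithmetic expressions. -/
inductive Expr
  | const (c : ℕ)
  | reg (r : Reg)
  | read (b : Arr) (i : Expr)
  | add (e f : Expr)
  | mul (e f : Expr)

/-- The value of an expression. -/
def Expr.val (s : State) : Expr → ℕ
  | const c => c
  | reg r => s.reg r
  | read b i => s.arr b (i.val s)
  | add e f => e.val s + f.val s
  | mul e f => e.val s * f.val s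

/-- The cost of evaluating an expression. -/
def Expr.cost (s : State) : Expr → ℕ × ℕ
  | const c => (1, bitLen c)
  | reg r => (1, bitLen (s.reg r))
  | read b i => i.cost s + (1, bitLen (i.val s) + bitLen (s.arr b (i.val s)))
  | add e f => e.cost s + f.cost s + (1, bitLen (e.val s) + bitLen (f.val s))
  | mul e f => e.cost s + f.cost s + (1, mulBits (e.val s) (f.val s))

/-- Tests. -/
inductive Test
  | lt (e f : Expr)
  | eq (e f : Expr)

/-- The truth value of a test. -/
def Test.holds (s : State) : Test → Prop
  | lt e f => e.val s < f.val s
  | eq e f => e.val s = f.val s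

/-- The cost of a test. -/
def Test.cost (s : State) : Test → ℕ × ℕ
  | lt e f => e.cost s + f.cost s + (1, bitLen (e.val s) + bitLen (f.val s))
  | eq e f => e.cost s + f.cost s + (1, bitLen (e.val s) + bitLen (f.val s))

/-- Programs. -/
inductive Prog
  | skip
  | assign (r : Reg) (e : Expr)
  | store (b : Arr) (i e : Expr)
  | seq (p q : Prog)
  | ite (t : Test) (p q : Prog)
  | while (t : Test) (p : Prog)

/-- `Exec p s s' c`: started in the state `s`, the program `p` halts in the state `s'`, and this run
has cost `c`. -/
inductive Exec : Prog → State → State → ℕ × ℕ → Prop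
  | skip (s : State) : Exec .skip s s (1, 1)
  | assign (r : Reg) (e : Expr) (s : State) :
      Exec (.assign r e) s (s.setReg r (e.val s)) (e.cost s + (1, bitLen (e.val s)))
  | store (b : Arr) (i e : Expr) (s : State) :
      Exec (.store b i e) s (s.setArr b (i.val s) (e.val s))
        (i.cost s + e.cost s + (1, bitLen (i.val s) + bitLen (e.val s)))
  | seq (p q : Prog) (s s' s'' : State) (c d : ℕ × ℕ) :
      Exec p s s' c → Exec q s' s'' d → Exec (.seq p q) s s'' (c + d)
  | ite_true (t : Test) (p q : Prog) (s s' : State) (c : ℕ × ℕ) :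
      t.holds s → Exec p s s' c → Exec (.ite t p q) s s' (t.cost s + c)
  | ite_false (t : Test) (p q : Prog) (s s' : State) (c : ℕ × ℕ) :
      ¬ t.holds s → Exec q s s' c → Exec (.ite t p q) s s' (t.cost s + c)
  | while_true (t : Test) (p : Prog) (s s' s'' : State) (c d : ℕ × ℕ) :
      t.holds s → Exec p s s' c → Exec (.while t p) s' s'' d →
        Exec (.while t p) s s'' (t.cost s + c + d)
  | while_false (t : Test) (p : Prog) (s : State) :
      ¬ t.holds s → Exec (.while t p) s s (t.cost s)

/-- Runs are deterministic: the final state and the cost are determined by the initial state. -/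
theorem Exec.deterministic {p : Prog} {s s₁ s₂ : State} {c₁ c₂ : ℕ × ℕ}
    (h₁ : Exec p s s₁ c₁) (h₂ : Exec p s s₂ c₂) : s₁ = s₂ ∧ c₁ = c₂ := by
  induction h₁ generalizing s₂ c₂ with
  | skip s => cases h₂; exact ⟨rfl, rfl⟩
  | assign r e s => cases h₂; exact ⟨rfl, rfl⟩
  | store b i e s => cases h₂; exact ⟨rfl, rfl⟩
  | seq p q s s' s'' c d _ _ ih₁ ih₂ =>
    cases h₂ with
    | seq _ _ _ t' _ c' d' hp hq =>
      obtain ⟨rfl, rfl⟩ := ih₁ hp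
      obtain ⟨rfl, rfl⟩ := ih₂ hq
      exact ⟨rfl, rfl⟩
  | ite_true t p q s s' c ht _ ih =>
    cases h₂ with
    | ite_true _ _ _ _ _ _ _ hp => obtain ⟨rfl, rfl⟩ := ih hp; exact ⟨rfl, rfl⟩
    | ite_false _ _ _ _ _ _ hn _ => exact absurd ht hn
  | ite_false t p q s s' c ht _ ih =>
    cases h₂ with
    | ite_true _ _ _ _ _ _ hn _ => exact absurd hn ht
    | ite_false _ _ _ _ _ _ _ hp => obtain ⟨rfl, rfl⟩ := ih hp; exact ⟨rfl, rfl⟩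
  | while_true t p s s' s'' c d ht _ _ ih₁ ih₂ =>
    cases h₂ with
    | while_true _ _ _ t' _ c' d' _ hp hq =>
      obtain ⟨rfl, rfl⟩ := ih₁ hp
      obtain ⟨rfl, rfl⟩ := ih₂ hq
      exact ⟨rfl, rfl⟩
    | while_false _ _ _ hn => exact absurd ht hn
  | while_false t p s ht =>
    cases h₂ with
    | while_true _ _ _ _ _ _ _ hn _ _ => exact absurd hn ht
    | while_false _ _ _ _ => exact ⟨rfl, rfl⟩

/-- `for r = 0, …, size - 1 do p`. -/
def forAll (r : Reg) (p : Prog) : Prog :=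
  .seq (.assign r (.const 0))
    (.while (.lt (.reg r) (.reg .size))
      (.seq p (.assign r (.add (.reg r) (.const 1)))))

end RAM

/-! ### Algorithm A -/

namespace AlgorithmA

open RAM

/-- The entry of the adjacency matrix in row `x` and column `y`; the matrix is stored row by row. -/
def entry : Expr := .read .adj (.add (.mul (.reg .x) (.reg .size)) (.reg .y))

/-- Form the vector of vertex degrees (the row sums of the adjacency matrix). -/
def degrees : Prog :=
  forAll .x
    (.seq (.assign .acc (.const 0))
    (.seq (forAll .y (.assign .acc (.add (.reg .acc) entry)))
          (.store .D1 (.reg .x) (.reg .acc))))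

/-- Compute the product of the adjacency matrix with the vector `src` and store it in `dst`. -/
def mulVec (src dst : Arr) : Prog :=
  forAll .x
    (.seq (.assign .acc (.const 0))
    (.seq (forAll .y (.assign .acc (.add (.reg .acc) (.mul entry (.read src (.reg .y))))))
          (.store dst (.reg .x) (.reg .acc))))

/-- The test that the entries `x` and `y` of the vector `b` are equal. -/
def sameEntry (b : Arr) : Test := .eq (.read b (.reg .x)) (.read b (.reg .y))

/-- Set `dup` to `1` if the matrix with the columns `D1`, `D2`, `D3` has two identical rows, and to
`0` otherwise. -/
def findDuplicates : Prog :=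
  .seq (.assign .dup (.const 0))
    (forAll .x (forAll .y
      (.ite (.lt (.reg .x) (.reg .y))
        (.ite (sameEntry .D1)
          (.ite (sameEntry .D2)
            (.ite (sameEntry .D3) (.assign .dup (.const 1)) .skip) .skip) .skip) .skip)))

/-- To each vertex assign its row as a label, and report success. -/
def writeLabels : Prog :=
  .seq
    (forAll .x
      (.seq (.store .label (.mul (.const 3) (.reg .x)) (.read .D1 (.reg .x)))
      (.seq (.store .label (.add (.mul (.const 3) (.reg .x)) (.const 1)) (.read .D2 (.reg .x)))
            (.store .label (.add (.mul (.const 3) (.reg .x)) (.const 2)) (.read .D3 (.reg .x))))))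
    (.assign .success (.const 1))

/-- Algorithm A. -/
def program : Prog :=
  .seq degrees
  (.seq (mulVec .D1 .D2)
  (.seq (mulVec .D2 .D3)
  (.seq findDuplicates
        (.ite (.eq (.reg .dup) (.const 0)) writeLabels .skip))))

end AlgorithmA

/-! ### Graphs as inputs, labelings as outputs -/

namespace RAM

open Classical in
/-- The initial state for a graph on `n` vertices: the register `size` holds `n`, the array `adj`
holds the adjacency matrix row by row, and everything else is `0`. -/
noncomputable def inputState {n : ℕ} (G : SimpleGraph (Fin n)) : State where
  reg := fun r => if r = .size then n else 0
  arr := fun b j =>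
    if b = .adj ∧ ∃ u v : Fin n, j = (u : ℕ) * n + v ∧ G.Adj u v then 1 else 0

/-- The result read off a final state: the label of each vertex, a triple of natural numbers, or
`none` if the algorithm has given up. -/
def output (n : ℕ) (s : State) : Option (Fin n → Fin 3 → ℕ) :=
  if s.reg .success = 1 then some (fun v k => s.arr .label (3 * (v : ℕ) + (k : ℕ))) else none

/-- On input `G`, the program `p` halts with result `L` after a run of cost `c`. -/
def HaltsWith (p : Prog) {n : ℕ} (G : SimpleGraph (Fin n)) (L : Option (Fin n → Fin 3 → ℕ))
    (c : ℕ × ℕ) : Prop :=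
  ∃ s : State, Exec p (inputState G) s c ∧ output n s = L

/-- The program `p` canonizes `G`: on input `G` it assigns pairwise different labels to the
vertices, and on every isomorphic copy of `G` it produces the same labels, in the sense that every
isomorphism preserves them. -/
def Canonizes (p : Prog) {n : ℕ} (G : SimpleGraph (Fin n)) : Prop :=
  ∃ L : Fin n → Fin 3 → ℕ, Function.Injective L ∧ (∃ c, HaltsWith p G (some L) c) ∧
    ∀ (H : SimpleGraph (Fin n)) (α : G ≃g H),
      ∃ L' : Fin n → Fin 3 → ℕ, (∃ c, HaltsWith p H (some L') c) ∧ ∀ v, L' (α v) = L v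

end RAM

/-! ### Walk counts -/

/-- The number of walks of length `k` in `G` starting from `v`. -/
noncomputable def walkCount {V : Type*} (G : SimpleGraph V) (k : ℕ) (v : V) : ℕ :=
  Nat.card {w : Σ u : V, G.Walk v u // w.2.length = k}

open Classical in
open scoped Matrix in
/-- The row of the vertex `v` in the matrix with the columns `A 1`, `A² 1`, `A³ 1`, where `A` is the
adjacency matrix of `G` and `1` is the all-ones vector. -/
noncomputable def walkRow {n : ℕ} (G : SimpleGraph (Fin n)) (v : Fin n) : Fin 3 → ℕ :=
  fun k => ((G.adjMatrix ℕ) ^ ((k : ℕ) + 1) *ᵥ (fun _ => 1)) v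

/-- The probability `1 / 2` of each edge. -/
noncomputable def edgeProb : unitInterval := ⟨1 / 2, by norm_num, by norm_num⟩

/-!
The labels computed by Algorithm A are the rows of walk counts, which are invariant under
isomorphisms. Hence the algorithm canonizes every graph whose rows are pairwise different, and the
probabilistic claim is that two equal rows are unlikely in the uniformly random graph.

Fix `x ≠ y`. With `a` the adjacency matrix and `d` the degrees, the differences of the walk counts
of lengths one, two and three are `∑ z, (a x z - a y z)`, `∑ z, (a x z - a y z) * d z` and
`∑ u, β u * d u`, where `β u = ∑ z, (a x z - a y z) * a z u`. Call a vertex agreeing if it is joined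
to both or to none of `x` and `y`, and private if it is joined to `x` only. Each difference strictly
increases when edges are added in a set of pairs on which the coefficients do not depend:
* the first one for the pairs at `x`;
* the second one for the pairs of private vertices, which do not affect the first one;
* the third one (or its negative) for the pairs of agreeing vertices `u` with `β u > 0` (or
  `β u < 0`), which affect neither `β` nor the first two.
So, with everything else fixed, the graphs for which a difference vanishes form an antichain, and by
Sperner's theorem they have density `O(k ^ (-1/2))`, where `k` is the number of pairs
(`SimpleGraph.Resamples.ncard_inter_le_of_antichain`). The three sets of pairs have sizes of order
`n`, `n²` and `n²`, except for an exponentially small proportion of the graphs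
(`SimpleGraph.Resamples.ncard_inter_le_of_close`), which makes the three coincidences together have
probability `O(n ^ (-5/2))` (`SimpleGraph.ncard_coincidence`); the union bound over the `n²` pairs
of vertices leaves `O(n ^ (-1/2))`.

The statements on halting, on the result and on the running time follow from a Hoare logic with
costs, in which a program is charged the number of its operations and a bound for the numbers and
addresses that it handles (`RAM.Halts`). All of them are at most `3 n³ + 3`, so a single operation
has bit cost `O(log n log log n)`.
-/

/-! ### Antichains and small subsets of a finite set -/

/-- The upper bound for central binomial coefficients that complements
`Nat.four_pow_lt_mul_centralBinom`. -/
theorem Nat.centralBinom_sq_mul_le (j : ℕ) :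
    Nat.centralBinom j ^ 2 * (2 * j + 1) ≤ 16 ^ j := by
  induction j with
  | zero => simp
  | succ j ih =>
    have h := Nat.succ_mul_centralBinom_succ j
    have h1 : (j + 1) ^ 2 * (Nat.centralBinom (j + 1) ^ 2 * (2 * (j + 1) + 1)) ≤
        (j + 1) ^ 2 * 16 ^ (j + 1) := by
      calc (j + 1) ^ 2 * (Nat.centralBinom (j + 1) ^ 2 * (2 * (j + 1) + 1))
          = ((j + 1) * Nat.centralBinom (j + 1)) ^ 2 * (2 * j + 3) := by ring
        _ = (Nat.centralBinom j ^ 2 * (2 * j + 1)) * (4 * ((2 * j + 1) * (2 * j + 3))) := by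
            rw [h]; ring
        _ ≤ 16 ^ j * (4 * ((2 * j + 1) * (2 * j + 3))) := Nat.mul_le_mul_right _ ih
        _ ≤ 16 ^ j * (16 * (j + 1) ^ 2) := Nat.mul_le_mul_left _ (by nlinarith)
        _ = (j + 1) ^ 2 * 16 ^ (j + 1) := by ring
    exact Nat.le_of_mul_le_mul_left h1 (by positivity)

theorem Nat.choose_half_sq_mul_le (m : ℕ) : (m.choose (m / 2)) ^ 2 * m ≤ 4 ^ m := by
  obtain ⟨j, rfl | rfl⟩ := m.even_or_odd'
  · have h := Nat.centralBinom_sq_mul_le j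
    rw [Nat.centralBinom] at h
    rw [Nat.mul_div_cancel_left j two_pos, pow_mul]
    norm_num
    nlinarith [h, sq_nonneg ((2 * j).choose j)]
  · have h := Nat.centralBinom_sq_mul_le (j + 1)
    have hc : Nat.centralBinom (j + 1) = 2 * (2 * j + 1).choose j := by
      rw [Nat.centralBinom, show 2 * (j + 1) = 2 * j + 1 + 1 by ring, Nat.choose_succ_succ,
        Nat.choose_symm_half]
      ring
    rw [hc] at h
    have h2 : (2 * j + 1) / 2 = j := by omega
    have h4 : 4 ^ (2 * j + 1) = 4 * 16 ^ j := by rw [pow_succ, pow_mul]; norm_num [mul_comm]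
    rw [h2, h4]
    rw [pow_succ 16 j] at h
    nlinarith [h, sq_nonneg ((2 * j + 1).choose j)]

/-- The bound of Sperner's theorem, relative to the number `2 ^ m` of all subsets. -/
theorem Nat.choose_half_le (m k : ℕ) (hk : 0 < k) (hkm : k ≤ m) :
    ((m.choose (m / 2) : ℕ) : ℝ) ≤ (√k)⁻¹ * 2 ^ m := by
  have h : ((m.choose (m / 2) : ℕ) : ℝ) ^ 2 * k ≤ 4 ^ m := by
    exact_mod_cast (Nat.mul_le_mul_left _ hkm).trans (Nat.choose_half_sq_mul_le m)
  have hk' : (0 : ℝ) < √k := Real.sqrt_pos.2 (by exact_mod_cast hk)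
  rw [inv_mul_eq_div, le_div_iff₀ hk']
  refine (pow_le_pow_iff_left₀ (by positivity) (by positivity) two_ne_zero).1 ?_
  rw [mul_pow, Real.sq_sqrt (Nat.cast_nonneg k), ← pow_mul, mul_comm m, pow_mul]
  norm_num
  exact h

open Finset in
/-- The subsets of `F` with at most `#F / 8` elements form an exponentially small proportion of all
subsets. -/
theorem Finset.card_powerset_filter_small_le {α : Type*} [DecidableEq α] (F : Finset α) :
    ((#{t ∈ F.powerset | 8 * #t ≤ #F} : ℕ) : ℝ) ≤ (3 / 4) ^ #F * 2 ^ #F := by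
  -- Give each `t` the weight `(4/5) ^ (8 #t)`, which is at least `(4/5) ^ #F` for the small sets.
  have key : ∑ t ∈ F.powerset, ((4 / 5 : ℝ) ^ 8) ^ #t = ((4 / 5) ^ 8 + 1) ^ #F := by
    rw [← Finset.sum_pow_mul_eq_add_pow]; simp
  have h1 : ((#{t ∈ F.powerset | 8 * #t ≤ #F} : ℕ) : ℝ) * (4 / 5) ^ #F ≤
      ((4 / 5) ^ 8 + 1) ^ #F := by
    rw [← key, ← nsmul_eq_mul]
    refine (Finset.card_nsmul_le_sum _ _ _ ?_).trans
      (Finset.sum_le_sum_of_subset_of_nonneg (Finset.filter_subset _ _) fun _ _ _ => by positivity)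
    intro t ht
    rw [← pow_mul]
    exact pow_le_pow_of_le_one (by norm_num) (by norm_num) (Finset.mem_filter.1 ht).2
  have h2 : ((4 / 5 : ℝ) ^ 8 + 1) ^ #F ≤ ((3 / 4) ^ #F * 2 ^ #F) * (4 / 5) ^ #F := by
    rw [← mul_pow, ← mul_pow]
    exact pow_le_pow_left₀ (by positivity) (by norm_num) _
  exact le_of_mul_le_mul_right (h1.trans h2) (by positivity)

/-! ### Resampling a set of edges -/

/-- If `B` has relative density at most `c` in every fibre of `q` on `A`, then it has relative
density at most `c` in `A`. -/
theorem Set.ncard_inter_le_of_fiberwise {Ω κ : Type*} [Finite Ω] (q : Ω → κ) (A B : Set Ω) (c : ℝ)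
    (h : ∀ ω ∈ A, (({ω' ∈ A | q ω' = q ω} ∩ B).ncard : ℝ) ≤ c * ({ω' ∈ A | q ω' = q ω}).ncard) :
    ((A ∩ B).ncard : ℝ) ≤ c * A.ncard := by
  classical
  have := Fintype.ofFinite Ω
  have hA : A.ncard = A.toFinset.card := Set.ncard_eq_toFinset_card' A
  have hB : (A ∩ B).ncard = (A ∩ B).toFinset.card := Set.ncard_eq_toFinset_card' _
  rw [hA, hB, Finset.card_eq_sum_card_fiberwise (f := q) (t := A.toFinset.image q)
      (s := (A ∩ B).toFinset) (by intro ω hω; simp at hω ⊢; exact ⟨ω, hω.1, rfl⟩),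
    Finset.card_eq_sum_card_fiberwise (f := q) (t := A.toFinset.image q)
      (s := A.toFinset) (by intro ω hω; simp at hω ⊢; exact ⟨ω, hω, rfl⟩)]
  push_cast
  rw [Finset.mul_sum]
  refine Finset.sum_le_sum fun k hk => ?_
  obtain ⟨ω, hω, rfl⟩ := Finset.mem_image.1 hk
  have := h ω (by simpa using hω)
  have e₁ : ({ω' ∈ A | q ω' = q ω} ∩ B).ncard = ((A ∩ B).toFinset.filter (q · = q ω)).card := by
    rw [← Set.ncard_coe_finset]
    congr 1
    ext
    simp
    tauto
  have e₂ : ({ω' ∈ A | q ω' = q ω}).ncard = (A.toFinset.filter (q · = q ω)).card := by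
    rw [← Set.ncard_coe_finset]
    congr 1
    ext
    simp
  rwa [e₁, e₂] at this

namespace SimpleGraph

variable {V : Type*}

/-- The graphs `G` and `G'` have the same edges outside the set `F` of pairs. -/
def SameOff (F : Finset (Sym2 V)) (G G' : SimpleGraph V) : Prop :=
  ∀ e ∉ F, e ∈ G'.edgeSet ↔ e ∈ G.edgeSet

theorem SameOff.adj {F : Finset (Sym2 V)} {G G' : SimpleGraph V} (h : SameOff F G G') {u v : V}
    (he : s(u, v) ∉ F) : G'.Adj u v ↔ G.Adj u v := h s(u, v) he

open Classical in
/-- The part of the edge set of `G` in `F`. -/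
noncomputable def edgesIn (F : Finset (Sym2 V)) (G : SimpleGraph V) : Finset (Sym2 V) :=
  F.filter (· ∈ G.edgeSet)

theorem mem_edgesIn {F : Finset (Sym2 V)} {G : SimpleGraph V} {e : Sym2 V} :
    e ∈ edgesIn F G ↔ e ∈ F ∧ e ∈ G.edgeSet := by simp [edgesIn]

theorem SameOff.le_of_edgesIn_subset {F : Finset (Sym2 V)} {G G₁ G₂ : SimpleGraph V}
    (h₁ : SameOff F G G₁) (h₂ : SameOff F G G₂) (h : edgesIn F G₁ ⊆ edgesIn F G₂) : G₁ ≤ G₂ := by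
  rw [← edgeSet_subset_edgeSet]
  intro e he
  by_cases hF : e ∈ F
  · exact (mem_edgesIn.1 (h (mem_edgesIn.2 ⟨hF, he⟩))).2
  · exact (h₂ e hF).2 ((h₁ e hF).1 he)

theorem SameOff.injOn_edgesIn (F : Finset (Sym2 V)) (G : SimpleGraph V) :
    Set.InjOn (edgesIn F) {G' | SameOff F G G'} := fun _ h₁ _ h₂ h =>
  le_antisymm (SameOff.le_of_edgesIn_subset h₁ h₂ h.subset)
    (SameOff.le_of_edgesIn_subset h₂ h₁ h.superset)

theorem ncard_sameOff [Finite V] (F : Finset (Sym2 V)) (hF : ∀ e ∈ F, ¬ e.IsDiag)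
    (G : SimpleGraph V) : {G' | SameOff F G G'}.ncard = 2 ^ F.card := by
  rw [← Finset.card_powerset, ← Set.ncard_coe_finset,
    ← (SameOff.injOn_edgesIn F G).ncard_image]
  congr 1
  ext t
  simp only [Set.mem_image, Set.mem_ofPred_eq, Finset.coe_powerset, Set.mem_preimage,
    Set.mem_powerset_iff, Finset.coe_subset]
  constructor
  · rintro ⟨G', -, rfl⟩ e he
    exact (mem_edgesIn.1 he).1
  · intro ht
    have hd : ∀ e, e ∈ (fromEdgeSet ((G.edgeSet \ F) ∪ t)).edgeSet ↔
        (e ∈ G.edgeSet ∧ e ∉ F) ∨ e ∈ t := by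
      intro e
      rw [edgeSet_fromEdgeSet]
      simp only [Set.mem_sdiff, Set.mem_union, Finset.mem_coe, Sym2.mem_diagSet]
      constructor
      · exact fun h => h.1
      · intro h
        refine ⟨h, ?_⟩
        rcases h with h | h
        · exact G.not_isDiag_of_mem_edgeSet h.1
        · exact hF e (ht h)
    refine ⟨fromEdgeSet ((G.edgeSet \ F) ∪ t), fun e he => ?_, ?_⟩
    · rw [hd]
      exact ⟨fun h => h.elim (·.1) fun h => absurd (ht h) he, fun h => .inl ⟨h, he⟩⟩
    · ext e
      rw [mem_edgesIn, hd]
      constructor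
      · rintro ⟨h, h' | h'⟩
        · exact absurd h h'.2
        · exact h'
      · exact fun h => ⟨ht h, .inr h⟩

/-- The set `F G` of pairs is determined, on the family `A`, by the edges of `G` outside of it, and
so is the membership in `A`. -/
structure Resamples (A : Set (SimpleGraph V)) (F : SimpleGraph V → Finset (Sym2 V)) : Prop where
  not_isDiag : ∀ G ∈ A, ∀ e ∈ F G, ¬ e.IsDiag
  mem : ∀ G ∈ A, ∀ G', SameOff (F G) G G' → G' ∈ A
  eq : ∀ G ∈ A, ∀ G', SameOff (F G) G G' → F G' = F G

/-- A bound for the density of `B` among the graphs that differ from a given one only in the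
resampled pairs is a bound for the density of `B` in `A`. -/
theorem Resamples.ncard_inter_le [Finite V] {A : Set (SimpleGraph V)}
    {F : SimpleGraph V → Finset (Sym2 V)} (h : Resamples A F) (B : Set (SimpleGraph V)) (c : ℝ)
    (hB : ∀ G ∈ A, (({G' | SameOff (F G) G G'} ∩ B).ncard : ℝ) ≤ c * 2 ^ (F G).card) :
    ((A ∩ B).ncard : ℝ) ≤ c * A.ncard := by
  refine Set.ncard_inter_le_of_fiberwise
    (fun G : SimpleGraph V => (F G, {e | e ∈ G.edgeSet ∧ e ∉ F G})) A B c fun G hG => ?_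
  have key : {G' ∈ A | (F G', {e | e ∈ G'.edgeSet ∧ e ∉ F G'}) =
      (F G, {e | e ∈ G.edgeSet ∧ e ∉ F G})} = {G' | SameOff (F G) G G'} := by
    ext G'
    simp only [Set.mem_ofPred_eq, Prod.mk.injEq, Set.ext_iff]
    constructor
    · rintro ⟨-, hF, h'⟩ e he
      have := h' e
      rw [hF] at this
      tauto
    · intro h'
      have hF := h.eq G hG G' h'
      refine ⟨h.mem G hG G' h', hF, fun e => ?_⟩
      rw [hF]
      have := h' e
      tauto
  rw [key, ncard_sameOff (F G) (h.not_isDiag G hG) G]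
  exact_mod_cast hB G hG

/-- Anticoncentration: if no two graphs in `B` that differ only in the resampled pairs are
comparable, then Sperner's theorem bounds the density of `B`. -/
theorem Resamples.ncard_inter_le_of_antichain [Finite V] {A : Set (SimpleGraph V)}
    {F : SimpleGraph V → Finset (Sym2 V)} (h : Resamples A F) (B : Set (SimpleGraph V))
    {k : ℕ} (hk : 0 < k) (hkF : ∀ G ∈ A, k ≤ (F G).card)
    (hB : ∀ G ∈ A, ∀ G' ∈ A, SameOff (F G) G G' → G ∈ B → G' ∈ B → ¬ G < G') :
    ((A ∩ B).ncard : ℝ) ≤ (√k)⁻¹ * A.ncard := by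
  classical
  have := Fintype.ofFinite V
  refine h.ncard_inter_le B _ fun G hG => ?_
  refine le_trans ?_ (Nat.choose_half_le _ k hk (hkF G hG))
  rw [Nat.cast_le]
  -- Sperner's theorem applies to the subsets of a finite type, here that of the resampled pairs.
  let ι : SimpleGraph V → Finset (F G) := fun G' => Finset.univ.filter fun e => e.1 ∈ G'.edgeSet
  have hι : ∀ G₁ G₂, SameOff (F G) G G₁ → SameOff (F G) G G₂ → ι G₁ ⊆ ι G₂ → G₁ ≤ G₂ := by
    intro G₁ G₂ h₁ h₂ h
    refine SameOff.le_of_edgesIn_subset h₁ h₂ fun e he => ?_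
    rw [mem_edgesIn] at he ⊢
    have := @h ⟨e, he.1⟩ (by simpa [ι] using he.2)
    exact ⟨he.1, by simpa [ι] using this⟩
  have hinj : Set.InjOn ι ({G' | SameOff (F G) G G'} ∩ B) := fun G₁ h₁ G₂ h₂ h =>
    le_antisymm (hι _ _ h₁.1 h₂.1 h.subset) (hι _ _ h₂.1 h₁.1 h.superset)
  rw [← hinj.ncard_image, Set.ncard_eq_toFinset_card', ← Fintype.card_coe (F G)]
  refine IsAntichain.sperner ?_
  rw [Set.coe_toFinset]
  rintro _ ⟨G₁, h₁, rfl⟩ _ ⟨G₂, h₂, rfl⟩ hne hsub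
  have hle := hι _ _ h₁.1 h₂.1 hsub
  have hF := h.eq G hG G₁ h₁.1
  refine hB G₁ (h.mem G hG _ h₁.1) G₂ (h.mem G hG _ h₂.1) ?_ h₁.2 h₂.2
    (lt_of_le_of_ne hle fun h => hne (by rw [h]))
  rw [hF]
  exact fun e he => (h₂.1 e he).trans (h₁.1 e he).symm

/-- Concentration: the resampled edges form a uniformly random subset of `F G`, so they are close
to a given subset of `F G` with exponentially small probability only. -/
theorem Resamples.ncard_inter_le_of_close [Finite V] [DecidableEq V] {A : Set (SimpleGraph V)}
    {F : SimpleGraph V → Finset (Sym2 V)} (h : Resamples A F) (B : Set (SimpleGraph V))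
    {k : ℕ} (hkF : ∀ G ∈ A, k ≤ (F G).card)
    (hB : ∀ G ∈ A, ∃ C ⊆ F G, ∀ G', SameOff (F G) G G' → G' ∈ B →
      8 * (symmDiff (edgesIn (F G) G') C).card ≤ (F G).card) :
    ((A ∩ B).ncard : ℝ) ≤ (3 / 4) ^ k * A.ncard := by
  classical
  have := Fintype.ofFinite V
  refine h.ncard_inter_le B _ fun G hG => ?_
  obtain ⟨C, hC, hGC⟩ := hB G hG
  have h1 := Finset.card_powerset_filter_small_le (F G)
  have h2 : ((3 / 4 : ℝ)) ^ (F G).card * 2 ^ (F G).card ≤ (3 / 4) ^ k * 2 ^ (F G).card :=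
    mul_le_mul_of_nonneg_right
      (pow_le_pow_of_le_one (by norm_num) (by norm_num) (hkF G hG)) (by positivity)
  refine le_trans ?_ (h1.trans h2)
  rw [Nat.cast_le, ← Set.ncard_coe_finset]
  refine Set.ncard_le_ncard_of_injOn (fun G' => symmDiff (edgesIn (F G) G') C) ?_ ?_
    (Finset.finite_toSet _)
  · intro G' hG'
    simp only [Finset.coe_filter, Finset.mem_powerset, Set.mem_ofPred_eq]
    refine ⟨fun e he => ?_, hGC G' hG'.1 hG'.2⟩
    rw [Finset.mem_symmDiff] at he
    rcases he with he | he
    · exact (mem_edgesIn.1 he.1).1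
    · exact hC he.1
  · exact fun G₁ h₁ G₂ h₂ h => SameOff.injOn_edgesIn _ _ h₁.1 h₂.1 (symmDiff_left_injective C h)

end SimpleGraph

namespace SimpleGraph

/-! ### Stars and cliques of resampled pairs -/

section Pairs

variable {V : Type*} [DecidableEq V]

/-- The pairs joining the vertex `s` to the elements of `P`. -/
def starPairs (s : V) (P : Finset V) : Finset (Sym2 V) := P.image fun u => s(s, u)

/-- The pairs of distinct elements of `P`. -/
def cliquePairs (P : Finset V) : Finset (Sym2 V) := P.offDiag.image fun p => s(p.1, p.2)

theorem mk_mem_starPairs {s : V} {P : Finset V} {u v : V} :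
    s(u, v) ∈ starPairs s P ↔ u = s ∧ v ∈ P ∨ v = s ∧ u ∈ P := by
  simp only [starPairs, Finset.mem_image, Sym2.eq_iff]
  constructor
  · rintro ⟨w, hw, ⟨rfl, rfl⟩ | ⟨rfl, rfl⟩⟩ <;> simp [hw]
  · rintro (⟨rfl, h⟩ | ⟨rfl, h⟩)
    · exact ⟨v, h, .inl ⟨rfl, rfl⟩⟩
    · exact ⟨u, h, .inr ⟨rfl, rfl⟩⟩

theorem mk_mem_cliquePairs {P : Finset V} {u v : V} :
    s(u, v) ∈ cliquePairs P ↔ u ∈ P ∧ v ∈ P ∧ u ≠ v := by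
  simp only [cliquePairs, Finset.mem_image, Finset.mem_offDiag, Sym2.eq_iff, Prod.exists]
  constructor
  · rintro ⟨a, b, ⟨ha, hb, hab⟩, ⟨rfl, rfl⟩ | ⟨rfl, rfl⟩⟩
    · exact ⟨ha, hb, hab⟩
    · exact ⟨hb, ha, hab.symm⟩
  · exact fun h => ⟨u, v, h, .inl ⟨rfl, rfl⟩⟩

theorem card_starPairs (s : V) (P : Finset V) : (starPairs s P).card = P.card :=
  Finset.card_image_of_injective _ fun _ _ h => Sym2.congr_right.1 h

theorem sq_le_card_cliquePairs {P : Finset V} {q : ℕ} (h : 2 * q ≤ P.card) :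
    q ^ 2 ≤ (cliquePairs P).card := by
  have h1 : (cliquePairs P).card = P.card.choose 2 := Sym2.card_image_offDiag P
  rw [h1]
  refine le_trans ?_ (Nat.choose_le_choose 2 h)
  rw [Nat.choose_two_right, mul_assoc, Nat.mul_div_cancel_left _ two_pos]
  rcases q with _ | q
  · simp
  · rw [sq]
    exact Nat.mul_le_mul_left _ (by omega)

theorem not_isDiag_of_mem_starPairs {s : V} {P : Finset V} (hs : s ∉ P) :
    ∀ e ∈ starPairs s P, ¬ e.IsDiag := by
  intro e he
  obtain ⟨u, hu, rfl⟩ := Finset.mem_image.1 he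
  rw [Sym2.mk_isDiag_iff]
  rintro rfl
  exact hs hu

theorem not_isDiag_of_mem_cliquePairs {P : Finset V} : ∀ e ∈ cliquePairs P, ¬ e.IsDiag := by
  intro e
  induction e with
  | h u v => intro h; rw [mk_mem_cliquePairs] at h; simpa using h.2.2

end Pairs

/-! ### Differences of walk counts -/

variable {V : Type*}

open Classical in
/-- The entries of the adjacency matrix, as integers. -/
noncomputable def adjZ (G : SimpleGraph V) (u v : V) : ℤ := if G.Adj u v then 1 else 0

theorem adjZ_congr {G G' : SimpleGraph V} {u v : V} (h : G'.Adj u v ↔ G.Adj u v) :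
    adjZ G' u v = adjZ G u v := by
  unfold adjZ
  classical exact if_congr h rfl rfl

theorem adjZ_mono {G G' : SimpleGraph V} (h : G ≤ G') (u v : V) : adjZ G u v ≤ adjZ G' u v := by
  by_cases hG : G.Adj u v
  · simp [adjZ, hG, h hG]
  · by_cases hG' : G'.Adj u v <;> simp [adjZ, hG, hG']

theorem adjZ_lt {G G' : SimpleGraph V} {u v : V} (h : ¬ G.Adj u v) (h' : G'.Adj u v) :
    adjZ G u v < adjZ G' u v := by simp [adjZ, h, h']

theorem exists_adj_of_lt {G G' : SimpleGraph V} (h : G < G') : ∃ u v, ¬ G.Adj u v ∧ G'.Adj u v := by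
  by_contra! H
  exact h.not_ge fun u v huv => by_contra fun h' => H u v h' huv

variable [Fintype V]

/-- The degree of a vertex, as an integer. -/
noncomputable def degZ (G : SimpleGraph V) (u : V) : ℤ := ∑ v, adjZ G u v

/-- The sum of `f` over the neighbours of `x` minus the sum of `f` over the neighbours of `y`. -/
noncomputable def gap (G : SimpleGraph V) (x y : V) (f : V → ℤ) : ℤ :=
  ∑ z, (adjZ G x z - adjZ G y z) * f z

/-- The number of common neighbours of `x` and `u` minus that of `y` and `u`. -/
noncomputable def codegGap (G : SimpleGraph V) (x y u : V) : ℤ := gap G x y fun z => adjZ G z u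

/-- The difference of the numbers of walks of length three from `x` and from `y`, arranged by the
second vertex that the walk reaches. -/
noncomputable def walkGap (G : SimpleGraph V) (x y : V) : ℤ := ∑ u, codegGap G x y u * degZ G u

/-- Exchanging the summations over the first and the second vertex that a walk of length three
reaches. -/
theorem gap_sum_adjZ (G : SimpleGraph V) (x y : V) :
    gap G x y (fun z => ∑ u, adjZ G z u * degZ G u) = walkGap G x y := by
  simp only [walkGap, codegGap, gap, Finset.mul_sum, Finset.sum_mul]
  rw [Finset.sum_comm]
  simp only [mul_assoc]

open Classical in
/-- The neighbours of `x`, other than `y`, that are not neighbours of `y`. -/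
noncomputable def privateNbrs (G : SimpleGraph V) (x y : V) : Finset V :=
  {z | z ≠ y ∧ G.Adj x z ∧ ¬ G.Adj y z}

open Classical in
/-- The vertices other than `x` and `y` that are adjacent to both or to none of the two. -/
noncomputable def agreeing (G : SimpleGraph V) (x y : V) : Finset V :=
  {z | z ≠ x ∧ z ≠ y ∧ (G.Adj x z ↔ G.Adj y z)}

theorem mem_privateNbrs {G : SimpleGraph V} {x y z : V} :
    z ∈ privateNbrs G x y ↔ z ≠ y ∧ G.Adj x z ∧ ¬ G.Adj y z := by simp [privateNbrs]

theorem mem_agreeing {G : SimpleGraph V} {x y z : V} :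
    z ∈ agreeing G x y ↔ z ≠ x ∧ z ≠ y ∧ (G.Adj x z ↔ G.Adj y z) := by simp [agreeing]

theorem left_notMem_privateNbrs {G : SimpleGraph V} {x y : V} : x ∉ privateNbrs G x y := by
  simp [mem_privateNbrs]

theorem right_notMem_privateNbrs {G : SimpleGraph V} {x y : V} : y ∉ privateNbrs G x y := by
  simp [mem_privateNbrs]

theorem adjZ_sub_of_mem_privateNbrs {G : SimpleGraph V} {x y z : V} (h : z ∈ privateNbrs G x y) :
    adjZ G x z - adjZ G y z = 1 := by
  rw [mem_privateNbrs] at h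
  simp [adjZ, h]

theorem adjZ_sub_of_mem_agreeing {G : SimpleGraph V} {x y z : V} (h : z ∈ agreeing G x y) :
    adjZ G x z - adjZ G y z = 0 := by
  rw [sub_eq_zero]
  unfold adjZ
  classical exact if_congr (mem_agreeing.1 h).2.2 rfl rfl

open Classical in
/-- The number of neighbours of `x` minus that of `y`: common neighbours and an edge between the
two vertices do not matter. -/
theorem gap_one {G : SimpleGraph V} {x y : V} (hxy : x ≠ y) :
    gap G x y (fun _ => 1) = (privateNbrs G x y).card - (privateNbrs G y x).card := by
  have h1 : ∀ z, (adjZ G x z - adjZ G y z) * 1 =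
      (if z ∈ privateNbrs G x y then 1 else 0) - (if z ∈ privateNbrs G y x then 1 else 0)
      + ((if z = y then adjZ G x y else 0) - (if z = x then adjZ G x y else 0)) := by
    intro z
    simp only [mem_privateNbrs]
    by_cases hy : z = y
    · subst hy; simp [adjZ, hxy.symm]
    by_cases hx : z = x
    · subst hx; simp [adjZ, hxy, G.adj_comm]
    · by_cases h1 : G.Adj x z <;> by_cases h2 : G.Adj y z <;> simp [adjZ, hx, hy, h1, h2]
  rw [gap, Finset.sum_congr rfl fun z _ => h1 z, Finset.sum_add_distrib, Finset.sum_sub_distrib,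
    Finset.sum_sub_distrib]
  simp

variable {G G' : SimpleGraph V} {x y : V}

theorem gap_congr (hx : ∀ z, G'.Adj x z ↔ G.Adj x z)
    (hy : ∀ z, G'.Adj y z ↔ G.Adj y z) (f : V → ℤ) : gap G' x y f = gap G x y f :=
  Finset.sum_congr rfl fun z _ => by rw [adjZ_congr (hx z), adjZ_congr (hy z)]

theorem privateNbrs_congr (hx : ∀ z, G'.Adj x z ↔ G.Adj x z)
    (hy : ∀ z, G'.Adj y z ↔ G.Adj y z) : privateNbrs G' x y = privateNbrs G x y := by
  ext z; simp [mem_privateNbrs, hx, hy]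

theorem agreeing_congr (hx : ∀ z, G'.Adj x z ↔ G.Adj x z)
    (hy : ∀ z, G'.Adj y z ↔ G.Adj y z) : agreeing G' x y = agreeing G x y := by
  ext z; simp [mem_agreeing, hx, hy]

variable [DecidableEq V] {P : Finset V}

omit [Fintype V] in
theorem SameOff.adj_of_notMem_left (h : SameOff (cliquePairs P) G G') {u : V} (hu : u ∉ P)
    (v : V) : G'.Adj u v ↔ G.Adj u v := h.adj fun h => hu (mk_mem_cliquePairs.1 h).1

theorem SameOff.degZ_of_notMem (h : SameOff (cliquePairs P) G G') {u : V} (hu : u ∉ P) :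
    degZ G' u = degZ G u :=
  Finset.sum_congr rfl fun v _ => adjZ_congr (h.adj_of_notMem_left hu v)

omit [DecidableEq V] in
theorem degZ_mono (h : G ≤ G') (u : V) : degZ G u ≤ degZ G' u :=
  Finset.sum_le_sum fun v _ => adjZ_mono h u v

theorem SameOff.exists_degZ_lt (h : SameOff (cliquePairs P) G G') (hlt : G < G') :
    ∃ u ∈ P, degZ G u < degZ G' u := by
  obtain ⟨u, v, huv, huv'⟩ := exists_adj_of_lt hlt
  refine ⟨u, by_contra fun hu => huv ((h.adj_of_notMem_left hu v).1 huv'), ?_⟩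
  exact Finset.sum_lt_sum (fun w _ => adjZ_mono hlt.le u w) ⟨v, Finset.mem_univ v, adjZ_lt huv huv'⟩

/-- New edges inside `P` increase a linear form in the degrees whose coefficients on `P` are
positive. -/
theorem SameOff.sum_mul_degZ_lt (h : SameOff (cliquePairs P) G G') (hlt : G < G') (c : V → ℤ)
    (hc : ∀ u ∈ P, 0 < c u) : ∑ u, c u * degZ G u < ∑ u, c u * degZ G' u := by
  obtain ⟨u, hu, hlt'⟩ := h.exists_degZ_lt hlt
  refine Finset.sum_lt_sum (fun v _ => ?_)
    ⟨u, Finset.mem_univ u, mul_lt_mul_of_pos_left hlt' (hc u hu)⟩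
  by_cases hv : v ∈ P
  · exact mul_le_mul_of_nonneg_left (degZ_mono hlt.le v) (hc v hv).le
  · rw [h.degZ_of_notMem hv]

/-- Edges between vertices that are adjacent to both or to none of `x` and `y` do not matter for
the codegree differences. -/
theorem SameOff.codegGap_eq (h : SameOff (cliquePairs P) G G') (hP : P ⊆ agreeing G x y) (u : V) :
    codegGap G' x y u = codegGap G x y u := by
  have hx : x ∉ P := fun hx => (mem_agreeing.1 (hP hx)).1 rfl
  have hy : y ∉ P := fun hy => (mem_agreeing.1 (hP hy)).2.1 rfl
  rw [codegGap, gap_congr (h.adj_of_notMem_left hx) (h.adj_of_notMem_left hy)]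
  refine Finset.sum_congr rfl fun z _ => ?_
  by_cases hz : z ∈ P
  · rw [adjZ_sub_of_mem_agreeing (hP hz), zero_mul, zero_mul]
  · simp only [adjZ_congr (h.adj_of_notMem_left hz u)]

end SimpleGraph

namespace SimpleGraph

/-! ### Coincidences for a fixed pair of vertices are rare -/

variable {V : Type*} [Fintype V] [DecidableEq V] {x y : V}

/-- The vertices other than `x` and `y`. -/
def others (x y : V) : Finset V := {x, y}ᶜ

theorem mem_others {z : V} : z ∈ others x y ↔ z ≠ x ∧ z ≠ y := by simp [others]

theorem card_others (hxy : x ≠ y) : (others x y).card = Fintype.card V - 2 := by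
  rw [others, Finset.card_compl, Finset.card_pair hxy]

/-- Resampling the edges at `x`, except for the pair `xy`. -/
theorem resamples_star (x y : V) :
    Resamples Set.univ fun _ => starPairs x (others x y) where
  not_isDiag _ _ := not_isDiag_of_mem_starPairs (by simp [mem_others])
  mem _ _ _ _ := trivial
  eq _ _ _ _ := rfl

theorem SameOff.adj_right_of_star {G G' : SimpleGraph V} (hxy : x ≠ y)
    (h : SameOff (starPairs x (others x y)) G G') (z : V) : G'.Adj y z ↔ G.Adj y z := by
  refine h.adj ?_
  rw [mk_mem_starPairs]
  simp [mem_others, hxy.symm]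

/-- Whether a vertex is joined to exactly one of `x` and `y` is decided by a fair coin, the edge to
`x`, so that few graphs have few such vertices. -/
theorem ncard_private_small (hxy : x ≠ y) :
    ({G : SimpleGraph V | 8 * ((privateNbrs G x y).card + (privateNbrs G y x).card) ≤
      Fintype.card V - 2}.ncard : ℝ) ≤
      (3 / 4) ^ (Fintype.card V - 2) * (Set.univ : Set (SimpleGraph V)).ncard := by
  classical
  rw [← Set.univ_inter {G : SimpleGraph V | _}]
  refine (resamples_star x y).ncard_inter_le_of_close _
    (fun _ _ => by rw [card_starPairs, card_others hxy]) fun G _ =>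
    ⟨starPairs x ((others x y).filter fun z => G.Adj y z),
      Finset.image_subset_image (Finset.filter_subset _ _), fun G' hG' hB => ?_⟩
  rw [card_starPairs, card_others hxy]
  refine le_trans (Nat.mul_le_mul_left _ ?_) hB
  refine le_trans ?_ (Finset.card_union_le _ _)
  rw [← card_starPairs x]
  refine Finset.card_le_card fun e he => ?_
  have hmem : e ∈ starPairs x (others x y) := by
    rcases Finset.mem_symmDiff.1 he with h | h
    · exact (mem_edgesIn.1 h.1).1
    · exact Finset.image_subset_image (Finset.filter_subset _ _) h.1
  obtain ⟨z, hz, rfl⟩ := Finset.mem_image.1 hmem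
  have hz' := mem_others.1 hz
  rw [Finset.mem_symmDiff, mem_edgesIn, mk_mem_starPairs, mk_mem_starPairs, mem_edgeSet] at he
  refine Finset.mem_image_of_mem _ ?_
  simp only [Finset.mem_filter, hz, hz'.1, true_and, and_true, false_and, or_false,
    ← hG'.adj_right_of_star hxy] at he
  rw [Finset.mem_union, mem_privateNbrs, mem_privateNbrs]
  tauto

/-- Whether a vertex is agreeing is decided by a fair coin as well. -/
theorem ncard_agreeing_small (hxy : x ≠ y) :
    ({G : SimpleGraph V | 8 * (agreeing G x y).card ≤ Fintype.card V - 2}.ncard : ℝ) ≤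
      (3 / 4) ^ (Fintype.card V - 2) * (Set.univ : Set (SimpleGraph V)).ncard := by
  classical
  rw [← Set.univ_inter {G : SimpleGraph V | _}]
  refine (resamples_star x y).ncard_inter_le_of_close _
    (fun _ _ => by rw [card_starPairs, card_others hxy]) fun G _ =>
    ⟨starPairs x ((others x y).filter fun z => ¬ G.Adj y z),
      Finset.image_subset_image (Finset.filter_subset _ _), fun G' hG' hB => ?_⟩
  rw [card_starPairs, card_others hxy]
  refine le_trans (Nat.mul_le_mul_left _ ?_) hB
  rw [← card_starPairs x]
  refine Finset.card_le_card fun e he => ?_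
  have hmem : e ∈ starPairs x (others x y) := by
    rcases Finset.mem_symmDiff.1 he with h | h
    · exact (mem_edgesIn.1 h.1).1
    · exact Finset.image_subset_image (Finset.filter_subset _ _) h.1
  obtain ⟨z, hz, rfl⟩ := Finset.mem_image.1 hmem
  have hz' := mem_others.1 hz
  rw [Finset.mem_symmDiff, mem_edgesIn, mk_mem_starPairs, mk_mem_starPairs, mem_edgeSet] at he
  refine Finset.mem_image_of_mem _ ?_
  simp only [Finset.mem_filter, hz, hz'.1, true_and, and_true, false_and, or_false,
    ← hG'.adj_right_of_star hxy] at he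
  rw [mem_agreeing]
  tauto

/-- The first resampling: the edges at `x`. -/
theorem ncard_gap_one_eq_zero (hxy : x ≠ y) (hV : 2 < Fintype.card V) :
    ({G : SimpleGraph V | gap G x y (fun _ => 1) = 0}.ncard : ℝ) ≤
      (√(Fintype.card V - 2 : ℕ))⁻¹ * (Set.univ : Set (SimpleGraph V)).ncard := by
  rw [← Set.univ_inter {G : SimpleGraph V | _}]
  refine (resamples_star x y).ncard_inter_le_of_antichain _ (by omega)
    (fun _ _ => by rw [card_starPairs, card_others hxy]) fun G _ G' _ h hG hG' hlt => ?_
  have hne : gap G x y (fun _ => 1) < gap G' x y (fun _ => 1) := by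
    have hy : ∀ z, adjZ G' y z = adjZ G y z := fun z => adjZ_congr (h.adj_right_of_star hxy z)
    obtain ⟨u, v, huv, huv'⟩ := exists_adj_of_lt hlt
    have hmem : s(u, v) ∈ starPairs x (others x y) := by
      by_contra hn
      exact huv ((h.adj hn).1 huv')
    have hex : ∃ z, ¬ G.Adj x z ∧ G'.Adj x z := by
      rcases mk_mem_starPairs.1 hmem with ⟨rfl, -⟩ | ⟨rfl, -⟩
      · exact ⟨v, huv, huv'⟩
      · exact ⟨u, fun h => huv h.symm, huv'.symm⟩
    obtain ⟨z, hz, hz'⟩ := hex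
    refine Finset.sum_lt_sum (fun w _ => ?_) ⟨z, Finset.mem_univ z, ?_⟩
    · have := adjZ_mono hlt.le x w
      rw [hy]
      linarith
    · have := adjZ_lt hz hz'
      rw [hy]
      linarith
  exact hne.ne (hG.trans hG'.symm)

/-- The second resampling: the edges inside the set of private neighbours of `x`. -/
theorem ncard_gap_degZ_eq_zero (hxy : x ≠ y) {q : ℕ} (hq : 0 < q)
    (hV : 32 * q + 2 ≤ Fintype.card V) :
    (({G : SimpleGraph V | gap G x y (fun _ => 1) = 0 ∧
        Fintype.card V - 2 < 8 * ((privateNbrs G x y).card + (privateNbrs G y x).card)} ∩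
      {G | gap G x y (degZ G) = 0}).ncard : ℝ) ≤
      (q : ℝ)⁻¹ * {G : SimpleGraph V | gap G x y (fun _ => 1) = 0}.ncard := by
  set A := {G : SimpleGraph V | gap G x y (fun _ => 1) = 0 ∧
        Fintype.card V - 2 < 8 * ((privateNbrs G x y).card + (privateNbrs G y x).card)}
  have hsame : ∀ {G G' : SimpleGraph V}, SameOff (cliquePairs (privateNbrs G x y)) G G' →
      (∀ z, G'.Adj x z ↔ G.Adj x z) ∧ (∀ z, G'.Adj y z ↔ G.Adj y z) := fun h =>
    ⟨h.adj_of_notMem_left left_notMem_privateNbrs, h.adj_of_notMem_left right_notMem_privateNbrs⟩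
  have hres : Resamples A fun G => cliquePairs (privateNbrs G x y) := by
    refine ⟨fun _ _ => not_isDiag_of_mem_cliquePairs, fun G hG G' h => ?_, fun G hG G' h => ?_⟩
    · obtain ⟨hx, hy⟩ := hsame h
      refine ⟨(gap_congr hx hy _).trans hG.1, ?_⟩
      rw [privateNbrs_congr hx hy, privateNbrs_congr hy hx]
      exact hG.2
    · obtain ⟨hx, hy⟩ := hsame h
      simp only [privateNbrs_congr hx hy]
  have h1 := hres.ncard_inter_le_of_antichain {G | gap G x y (degZ G) = 0} (k := q ^ 2)
    (by positivity) (fun G hG => ?_) (fun G hG G' _ h hB hB' hlt => ?_)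
  · rw [Nat.cast_pow, Real.sqrt_sq (Nat.cast_nonneg q)] at h1
    refine h1.trans (mul_le_mul_of_nonneg_left ?_ (by positivity))
    rw [Nat.cast_le]
    exact Set.ncard_le_ncard (fun G hG => hG.1) (Set.toFinite _)
  -- The private neighbours of `x` and of `y` are equally many, and together more than `4 q`.
  · refine sq_le_card_cliquePairs ?_
    have h2 := gap_one (G := G) hxy
    have h3 := hG.1
    have h4 := hG.2
    omega
  · obtain ⟨hx, hy⟩ := hsame h
    have h2 : gap G x y (degZ G) < gap G x y (degZ G') :=
      h.sum_mul_degZ_lt hlt _ fun u hu => by rw [adjZ_sub_of_mem_privateNbrs hu]; norm_num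
    rw [← gap_congr hx hy (degZ G')] at h2
    exact h2.ne (Eq.trans hB (Eq.symm hB'))

open Classical in
/-- An arbitrary element of `P`, if there is one. -/
noncomputable def pick [Nonempty V] (P : Finset V) : V :=
  if h : P.Nonempty then h.choose else Classical.arbitrary V

omit [Fintype V] [DecidableEq V] in
theorem pick_mem [Nonempty V] {P : Finset V} (h : P.Nonempty) : pick P ∈ P := by
  rw [pick, dif_pos h]
  exact h.choose_spec

open Classical in
/-- Resampling the edges between one private neighbour of `x` and all agreeing vertices shows that
few codegree differences vanish: each of them vanishes for at most one of the two possible states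
of the edge. -/
theorem ncard_codegGap_small {q : ℕ} (hV : 8 * q + 2 ≤ Fintype.card V) :
    (({G : SimpleGraph V | (privateNbrs G x y).Nonempty ∧
        Fintype.card V - 2 < 8 * (agreeing G x y).card} ∩
      {G | 8 * ((agreeing G x y).filter fun u => codegGap G x y u ≠ 0).card ≤
        (agreeing G x y).card}).ncard : ℝ) ≤
      (3 / 4) ^ q * (Set.univ : Set (SimpleGraph V)).ncard := by
  have : Nonempty V := ⟨x⟩
  set A := {G : SimpleGraph V | (privateNbrs G x y).Nonempty ∧
    Fintype.card V - 2 < 8 * (agreeing G x y).card}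
  have hsx : ∀ G ∈ A, pick (privateNbrs G x y) ∈ privateNbrs G x y := fun G hG => pick_mem hG.1
  have hsU : ∀ G ∈ A, pick (privateNbrs G x y) ∉ agreeing G x y := by
    intro G hG h
    have h1 := hsx G hG
    rw [mem_privateNbrs] at h1
    rw [mem_agreeing] at h
    tauto
  have hsame : ∀ G ∈ A, ∀ G', SameOff (starPairs (pick (privateNbrs G x y)) (agreeing G x y)) G G' →
      (∀ z, G'.Adj x z ↔ G.Adj x z) ∧ (∀ z, G'.Adj y z ↔ G.Adj y z) := by
    intro G hG G' h
    have h1 := hsx G hG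
    constructor
    · refine fun z => h.adj ?_
      rw [mk_mem_starPairs]
      rintro (⟨h2, -⟩ | ⟨-, h2⟩)
      · rw [← h2] at h1
        exact left_notMem_privateNbrs h1
      · exact (mem_agreeing.1 h2).1 rfl
    · refine fun z => h.adj ?_
      rw [mk_mem_starPairs]
      rintro (⟨h2, -⟩ | ⟨-, h2⟩)
      · rw [← h2] at h1
        exact right_notMem_privateNbrs h1
      · exact (mem_agreeing.1 h2).2.1 rfl
  have hres : Resamples A fun G => starPairs (pick (privateNbrs G x y)) (agreeing G x y) := by
    refine ⟨fun G hG => not_isDiag_of_mem_starPairs (hsU G hG), fun G hG G' h => ?_,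
      fun G hG G' h => ?_⟩
    · obtain ⟨hx, hy⟩ := hsame G hG G' h
      show _ ∧ _
      rw [privateNbrs_congr hx hy, agreeing_congr hx hy]
      exact hG
    · obtain ⟨hx, hy⟩ := hsame G hG G' h
      simp only [privateNbrs_congr hx hy, agreeing_congr hx hy]
  have hcodeg : ∀ G ∈ A, ∀ G',
      SameOff (starPairs (pick (privateNbrs G x y)) (agreeing G x y)) G G' →
      ∀ u ∈ agreeing G x y, codegGap G' x y u =
        codegGap G x y u - adjZ G (pick (privateNbrs G x y)) u +
          adjZ G' (pick (privateNbrs G x y)) u := by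
    intro G hG G' h u hu
    obtain ⟨hx, hy⟩ := hsame G hG G' h
    have h1 : codegGap G' x y u - codegGap G x y u =
        adjZ G' (pick (privateNbrs G x y)) u - adjZ G (pick (privateNbrs G x y)) u := by
      rw [codegGap, gap_congr hx hy, codegGap, gap, gap, ← Finset.sum_sub_distrib,
        Finset.sum_eq_single (pick (privateNbrs G x y))]
      · rw [adjZ_sub_of_mem_privateNbrs (hsx G hG)]
        ring
      · intro z _ hz
        rw [sub_eq_zero]
        congr 1
        refine adjZ_congr (h.adj ?_)
        rw [mk_mem_starPairs]
        rintro (⟨h2, -⟩ | ⟨h2, -⟩)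
        · exact hz h2
        · rw [h2] at hu
          exact hsU G hG hu
      · simp
    linarith
  have h1 := hres.ncard_inter_le_of_close
    {G | 8 * ((agreeing G x y).filter fun u => codegGap G x y u ≠ 0).card ≤ (agreeing G x y).card}
    (k := q) (fun G hG => ?_) (fun G hG => ?_)
  · refine h1.trans (mul_le_mul_of_nonneg_left ?_ (by positivity))
    rw [Nat.cast_le]
    exact Set.ncard_le_ncard (Set.subset_univ _) (Set.toFinite _)
  · rw [card_starPairs]
    have := hG.2
    omega
  · set s := pick (privateNbrs G x y)
    refine ⟨starPairs s ((agreeing G x y).filter fun u => codegGap G x y u - adjZ G s u = -1),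
      Finset.image_subset_image (Finset.filter_subset _ _), fun G' h hB => ?_⟩
    obtain ⟨hx, hy⟩ := hsame G hG G' h
    have hsub : s ∉ agreeing G x y := hsU G hG
    rw [Set.mem_ofPred_eq, agreeing_congr hx hy] at hB
    rw [card_starPairs]
    refine le_trans (Nat.mul_le_mul_left _ ?_) hB
    rw [← card_starPairs s]
    refine Finset.card_le_card fun e he => ?_
    have hmem : e ∈ starPairs s (agreeing G x y) := by
      rcases Finset.mem_symmDiff.1 he with h | h
      · exact (mem_edgesIn.1 h.1).1
      · exact Finset.image_subset_image (Finset.filter_subset _ _) h.1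
    obtain ⟨u, hu, rfl⟩ := Finset.mem_image.1 hmem
    have hus : u ≠ s := fun h => hsub (h ▸ hu)
    refine Finset.mem_image_of_mem _ (Finset.mem_filter.2 ⟨hu, ?_⟩)
    rw [hcodeg G hG G' h u hu]
    simp only [Finset.mem_symmDiff, mem_edgesIn, mk_mem_starPairs, Finset.mem_filter, hu, hus,
      true_and, and_true, false_and, or_false, mem_edgeSet] at he
    rcases he with ⟨h2, h3⟩ | ⟨h2, h3⟩
    · have : adjZ G' s u = 1 := by simp [adjZ, h2]
      rw [this]
      intro h4
      exact h3 (by linarith)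
    · have : adjZ G' s u = 0 := by simp [adjZ, h3]
      rw [this, h2]
      norm_num

open Classical in
/-- The third resampling: the edges inside a set of agreeing vertices on which the codegree
differences have the sign `σ`. -/
theorem ncard_walkGap_eq_zero {q : ℕ} (hq : 0 < q) (hV : 256 * q + 2 ≤ Fintype.card V) (σ : ℤ) :
    (({G : SimpleGraph V | (gap G x y (fun _ => 1) = 0 ∧
        Fintype.card V - 2 < 8 * ((privateNbrs G x y).card + (privateNbrs G y x).card)) ∧
        gap G x y (degZ G) = 0 ∧ Fintype.card V - 2 < 8 * (agreeing G x y).card ∧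
        (agreeing G x y).card ≤
          16 * ((agreeing G x y).filter fun u => 0 < σ * codegGap G x y u).card} ∩
      {G | walkGap G x y = 0}).ncard : ℝ) ≤
      (q : ℝ)⁻¹ * ({G : SimpleGraph V | gap G x y (fun _ => 1) = 0 ∧
        Fintype.card V - 2 < 8 * ((privateNbrs G x y).card + (privateNbrs G y x).card)} ∩
        {G | gap G x y (degZ G) = 0}).ncard := by
  set P : SimpleGraph V → Finset V := fun G =>
    (agreeing G x y).filter fun u => 0 < σ * codegGap G x y u with hP
  set A := {G : SimpleGraph V | (gap G x y (fun _ => 1) = 0 ∧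
        Fintype.card V - 2 < 8 * ((privateNbrs G x y).card + (privateNbrs G y x).card)) ∧
        gap G x y (degZ G) = 0 ∧ Fintype.card V - 2 < 8 * (agreeing G x y).card ∧
        (agreeing G x y).card ≤ 16 * (P G).card} with hA
  have hPU : ∀ G, P G ⊆ agreeing G x y := fun G => Finset.filter_subset _ _
  have hsame : ∀ {G G' : SimpleGraph V}, SameOff (cliquePairs (P G)) G G' →
      (∀ z, G'.Adj x z ↔ G.Adj x z) ∧ (∀ z, G'.Adj y z ↔ G.Adj y z) := fun {G G'} h =>
    ⟨h.adj_of_notMem_left fun hx => (mem_agreeing.1 (hPU G hx)).1 rfl,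
      h.adj_of_notMem_left fun hy => (mem_agreeing.1 (hPU G hy)).2.1 rfl⟩
  have hPeq : ∀ {G G' : SimpleGraph V}, SameOff (cliquePairs (P G)) G G' → P G' = P G := by
    intro G G' h
    obtain ⟨hx, hy⟩ := hsame h
    simp only [hP, agreeing_congr hx hy, h.codegGap_eq (hPU G)]
  have hres : Resamples A fun G => cliquePairs (P G) := by
    refine ⟨fun _ _ => not_isDiag_of_mem_cliquePairs, fun G hG G' h => ?_, fun G hG G' h => ?_⟩
    · obtain ⟨hx, hy⟩ := hsame h
      -- Only degrees of agreeing vertices change, and those have coefficient zero.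
      have hdeg : gap G' x y (degZ G') = gap G x y (degZ G) := by
        rw [gap_congr hx hy]
        refine Finset.sum_congr rfl fun z _ => ?_
        by_cases hz : z ∈ P G
        · rw [adjZ_sub_of_mem_agreeing (hPU G hz), zero_mul, zero_mul]
        · rw [h.degZ_of_notMem hz]
      rw [hA, Set.mem_ofPred_eq] at hG ⊢
      rw [gap_congr hx hy, hdeg, privateNbrs_congr hx hy, privateNbrs_congr hy hx,
        agreeing_congr hx hy, hPeq h]
      exact hG
    · rw [hPeq h]
  have h1 := hres.ncard_inter_le_of_antichain {G | walkGap G x y = 0} (k := q ^ 2)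
    (by positivity) (fun G hG => ?_) (fun G hG G' _ h hB hB' hlt => ?_)
  · rw [Nat.cast_pow, Real.sqrt_sq (Nat.cast_nonneg q)] at h1
    refine h1.trans (mul_le_mul_of_nonneg_left ?_ (by positivity))
    rw [Nat.cast_le]
    exact Set.ncard_le_ncard (fun G hG => ⟨hG.1, hG.2.1⟩) (Set.toFinite _)
  · refine sq_le_card_cliquePairs ?_
    have h2 := hG.2.2
    omega
  · have h2 := h.sum_mul_degZ_lt hlt (fun u => σ * codegGap G x y u)
      fun u hu => (Finset.mem_filter.1 hu).2
    simp only [mul_assoc, ← Finset.mul_sum] at h2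
    have h3 : walkGap G' x y = ∑ u, codegGap G x y u * degZ G' u :=
      Finset.sum_congr rfl fun u _ => by rw [h.codegGap_eq (hPU G)]
    rw [← h3] at h2
    have hB1 : walkGap G x y = 0 := hB
    have hB2 : walkGap G' x y = 0 := hB'
    rw [hB2] at h2
    rw [walkGap] at hB1
    rw [hB1] at h2
    exact lt_irrefl _ h2

/-- The probability that `x` and `y` start equally many walks of each of the lengths one, two and
three is of order `q ^ (-5/2)`, where `q` is proportional to the number of vertices. -/
theorem ncard_coincidence (hxy : x ≠ y) {q : ℕ} (hq : 0 < q)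
    (hV : 256 * q + 2 ≤ Fintype.card V) :
    ({G : SimpleGraph V | gap G x y (fun _ => 1) = 0 ∧ gap G x y (degZ G) = 0 ∧
      walkGap G x y = 0}.ncard : ℝ) ≤
      (3 * (3 / 4) ^ q + 2 * ((q : ℝ)⁻¹ * ((q : ℝ)⁻¹ * (√q)⁻¹))) *
        (Set.univ : Set (SimpleGraph V)).ncard := by
  classical
  set N : ℝ := ((Set.univ : Set (SimpleGraph V)).ncard : ℝ) with hN
  have hN0 : 0 ≤ N := Nat.cast_nonneg _
  have hpow : ((3 / 4 : ℝ)) ^ (Fintype.card V - 2) * N ≤ (3 / 4) ^ q * N :=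
    mul_le_mul_of_nonneg_right
      (pow_le_pow_of_le_one (by norm_num) (by norm_num) (by omega)) hN0
  have b1 := (ncard_private_small hxy).trans hpow
  have b2 := (ncard_agreeing_small hxy).trans hpow
  have b3 := ncard_codegGap_small (x := x) (y := y) (q := q) (by omega)
  have b4 : ({G : SimpleGraph V | gap G x y (fun _ => 1) = 0}.ncard : ℝ) ≤ (√q)⁻¹ * N := by
    refine (ncard_gap_one_eq_zero hxy (by omega)).trans (mul_le_mul_of_nonneg_right ?_ hN0)
    refine inv_anti₀ (Real.sqrt_pos.2 (by exact_mod_cast hq)) (Real.sqrt_le_sqrt ?_)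
    exact_mod_cast (by omega : q ≤ Fintype.card V - 2)
  have b5 := (ncard_gap_degZ_eq_zero hxy hq (by omega)).trans
    (mul_le_mul_of_nonneg_left b4 (by positivity))
  have b6 := fun σ => (ncard_walkGap_eq_zero hq hV σ).trans
    (mul_le_mul_of_nonneg_left b5 (by positivity))
  have hle : ∀ S T : Set (SimpleGraph V), ((S ∪ T).ncard : ℝ) ≤ S.ncard + T.ncard :=
    fun S T => by exact_mod_cast Set.ncard_union_le S T
  have hunion : ∀ {B S₁ S₂ S₃ S₄ S₅ : Set (SimpleGraph V)} {c₁ c₂ c₃ c₄ c₅ : ℝ},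
      (S₁.ncard : ℝ) ≤ c₁ → (S₂.ncard : ℝ) ≤ c₂ → (S₃.ncard : ℝ) ≤ c₃ → (S₄.ncard : ℝ) ≤ c₄ →
      (S₅.ncard : ℝ) ≤ c₅ → B ⊆ S₁ ∪ (S₂ ∪ (S₃ ∪ (S₄ ∪ S₅))) →
      (B.ncard : ℝ) ≤ c₁ + (c₂ + (c₃ + (c₄ + c₅))) := by
    intro B S₁ S₂ S₃ S₄ S₅ c₁ c₂ c₃ c₄ c₅ h₁ h₂ h₃ h₄ h₅ hB
    have h0 := Set.ncard_le_ncard hB (Set.toFinite _)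
    rw [← Nat.cast_le (α := ℝ)] at h0
    linarith [hle S₁ (S₂ ∪ (S₃ ∪ (S₄ ∪ S₅))), hle S₂ (S₃ ∪ (S₄ ∪ S₅)), hle S₃ (S₄ ∪ S₅), hle S₄ S₅]
  refine (hunion b1 b2 b3 (b6 1) (b6 (-1)) fun G hG => ?_).trans (le_of_eq (by ring))
  by_cases c1 : 8 * ((privateNbrs G x y).card + (privateNbrs G y x).card) ≤ Fintype.card V - 2
  · exact .inl c1
  refine .inr ?_
  by_cases c2 : 8 * (agreeing G x y).card ≤ Fintype.card V - 2
  · exact .inl c2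
  refine .inr ?_
  have hne : (privateNbrs G x y).Nonempty := by
    rw [← Finset.card_pos]
    have h1 := gap_one (G := G) hxy
    have h2 := hG.1
    omega
  by_cases c3 : 8 * ((agreeing G x y).filter fun u => codegGap G x y u ≠ 0).card ≤
      (agreeing G x y).card
  · exact .inl ⟨⟨hne, not_le.1 c2⟩, c3⟩
  refine .inr ?_
  -- One of the two signs is taken by at least half of the nonzero codegree differences.
  have hsplit : (agreeing G x y).filter (fun u => codegGap G x y u ≠ 0) ⊆
      (agreeing G x y).filter (fun u => 0 < 1 * codegGap G x y u) ∪
      (agreeing G x y).filter (fun u => 0 < -1 * codegGap G x y u) := by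
    intro u hu
    simp only [Finset.mem_union, Finset.mem_filter] at hu ⊢
    rcases lt_or_gt_of_ne hu.2 with h | h
    · exact .inr ⟨hu.1, by linarith⟩
    · exact .inl ⟨hu.1, by linarith⟩
  have hcard := (Finset.card_le_card hsplit).trans (Finset.card_union_le _ _)
  by_cases c4 : (agreeing G x y).card ≤
      16 * ((agreeing G x y).filter fun u => 0 < 1 * codegGap G x y u).card
  · exact .inl ⟨⟨⟨hG.1, not_le.1 c1⟩, hG.2.1, not_le.1 c2, c4⟩, hG.2.2⟩
  · exact .inr ⟨⟨⟨hG.1, not_le.1 c1⟩, hG.2.1, not_le.1 c2, by omega⟩, hG.2.2⟩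

end SimpleGraph

/-! ### Walk counts and the uniform random graph -/

open Classical in
open scoped Matrix in
/-- The vector of the numbers of walks of length `k`, as a product of matrices. -/
noncomputable def walkVec {n : ℕ} (G : SimpleGraph (Fin n)) (k : ℕ) : Fin n → ℕ :=
  (G.adjMatrix ℕ) ^ k *ᵥ fun _ => 1

theorem walkRow_apply {n : ℕ} (G : SimpleGraph (Fin n)) (v : Fin n) (k : Fin 3) :
    walkRow G v k = walkVec G (k + 1) v := rfl

theorem walkVec_zero {n : ℕ} (G : SimpleGraph (Fin n)) (v : Fin n) : walkVec G 0 v = 1 := by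
  simp [walkVec]

open Classical in
theorem walkVec_succ {n : ℕ} (G : SimpleGraph (Fin n)) (k : ℕ) (v : Fin n) :
    walkVec G (k + 1) v = ∑ z, (if G.Adj v z then 1 else 0) * walkVec G k z := by
  rw [walkVec, pow_succ', ← Matrix.mulVec_mulVec]
  simp [Matrix.mulVec, dotProduct, SimpleGraph.adjMatrix_apply, walkVec]

theorem cast_walkVec_succ {n : ℕ} (G : SimpleGraph (Fin n)) (k : ℕ) (v : Fin n) :
    (walkVec G (k + 1) v : ℤ) = ∑ z, G.adjZ v z * walkVec G k z := by
  rw [walkVec_succ]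
  push_cast
  rfl

theorem walkVec_eq_walkCount {n : ℕ} (G : SimpleGraph (Fin n)) (k : ℕ) (v : Fin n) :
    walkVec G k v = walkCount G k v := by
  classical
  have h : ∀ u, Fintype.card {w : G.Walk v u // w.length = k} = (G.adjMatrix ℕ ^ k) v u := by
    intro u
    rw [SimpleGraph.adjMatrix_pow_apply_eq_card_walk, Nat.cast_id]
    rfl
  have e : {w : Σ u : Fin n, G.Walk v u // w.2.length = k} ≃
      Σ u : Fin n, {w : G.Walk v u // w.length = k} :=
    { toFun := fun w => ⟨w.1.1, w.1.2, w.2⟩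
      invFun := fun w => ⟨⟨w.1, w.2.1⟩, w.2.2⟩
      left_inv := fun _ => rfl
      right_inv := fun _ => rfl }
  rw [walkCount, Nat.card_congr e, Nat.card_eq_fintype_card, Fintype.card_sigma]
  simp only [h]
  simp only [walkVec, Matrix.mulVec, dotProduct, mul_one]

theorem walkRow_eq_walkCount {n : ℕ} (G : SimpleGraph (Fin n)) (v : Fin n) :
    walkRow G v = ![walkCount G 1 v, walkCount G 2 v, walkCount G 3 v] := by
  funext k
  rw [walkRow_apply, walkVec_eq_walkCount]
  fin_cases k <;> rfl

theorem gap_walkVec {n : ℕ} (G : SimpleGraph (Fin n)) (k : ℕ) (x y : Fin n) :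
    G.gap x y (fun z => walkVec G k z) = walkVec G (k + 1) x - walkVec G (k + 1) y := by
  rw [cast_walkVec_succ, cast_walkVec_succ, ← Finset.sum_sub_distrib]
  simp only [SimpleGraph.gap, sub_mul]

theorem gap_eq_zero_of_walkRow_eq {n : ℕ} {G : SimpleGraph (Fin n)} {x y : Fin n}
    (h : walkRow G x = walkRow G y) :
    G.gap x y (fun _ => 1) = 0 ∧ G.gap x y G.degZ = 0 ∧ G.walkGap x y = 0 := by
  have hw : ∀ k < 3, G.gap x y (fun z => walkVec G k z) = 0 := by
    intro k hk
    have := congrFun h ⟨k, hk⟩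
    rw [walkRow_apply, walkRow_apply] at this
    rw [gap_walkVec]
    simp only at this
    rw [this, sub_self]
  have h1 : (fun z => (walkVec G 1 z : ℤ)) = G.degZ := by
    funext z
    simp [cast_walkVec_succ, walkVec_zero, SimpleGraph.degZ]
  refine ⟨?_, ?_, ?_⟩
  · simpa [walkVec_zero] using hw 0 (by norm_num)
  · rw [← h1]
    exact hw 1 (by norm_num)
  · rw [← SimpleGraph.gap_sum_adjZ, ← hw 2 (by norm_num)]
    congr 1
    funext z
    rw [cast_walkVec_succ, ← h1]

/-- Walk counts are invariant under isomorphisms. -/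
theorem walkRow_iso {n : ℕ} {G H : SimpleGraph (Fin n)} (α : G ≃g H) (v : Fin n) :
    walkRow H (α v) = walkRow G v := by
  have h : ∀ k v, walkVec H k (α v) = walkVec G k v := by
    intro k
    induction k with
    | zero => intro v; rw [walkVec_zero, walkVec_zero]
    | succ k ih =>
      intro v
      rw [walkVec_succ, walkVec_succ, ← α.toEquiv.sum_comp]
      refine Finset.sum_congr rfl fun z _ => ?_
      classical exact congrArg₂ _ (if_congr α.map_adj_iff rfl rfl) (ih z)
  funext k
  exact h _ v

instance {V : Type*} [Countable V] : MeasurableSingletonClass (SimpleGraph V) where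
  measurableSet_singleton G := by
    have h : {G} = SimpleGraph.edgeSet ⁻¹' {G.edgeSet} := by
      ext G'
      simp
    rw [h]
    exact SimpleGraph.measurable_edgeSet (MeasurableSet.singleton _)

/-- The binomial random graph with edge probability `1 / 2` is uniformly distributed. -/
theorem binomialRandom_edgeProb_apply {n : ℕ} (S : Set (SimpleGraph (Fin n))) :
    SimpleGraph.binomialRandom (Fin n) edgeProb S =
      ENNReal.ofReal (S.ncard / (Set.univ : Set (SimpleGraph (Fin n))).ncard) := by
  classical
  set μ := SimpleGraph.binomialRandom (Fin n) edgeProb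
  obtain ⟨c, hc⟩ : ∃ c : ENNReal, ∀ G : SimpleGraph (Fin n), μ {G} = c := by
    refine ⟨((unitInterval.toNNReal edgeProb : NNReal) : ENNReal) ^ ((Nat.card (Fin n)).choose 2),
      fun G => ?_⟩
    have hσ : unitInterval.symm edgeProb = edgeProb := by
      ext
      simp [edgeProb, unitInterval.symm]
      norm_num
    have hle : G.edgeSet.ncard ≤ (Nat.card (Fin n)).choose 2 := by
      rw [Nat.card_eq_fintype_card, Set.ncard_eq_toFinset_card']
      exact G.card_edgeFinset_le_card_choose_two
    rw [SimpleGraph.binomialRandom_singleton, hσ, ← pow_add, Nat.add_sub_cancel' hle]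
  have hS : ∀ S : Set (SimpleGraph (Fin n)), μ S = S.ncard * c := by
    intro S
    rw [Set.ncard_eq_toFinset_card', ← nsmul_eq_mul, ← Finset.sum_const,
      ← Finset.sum_congr rfl fun G _ => hc G, MeasureTheory.sum_measure_singleton, Set.coe_toFinset]
  have h1 : ((Set.univ : Set (SimpleGraph (Fin n))).ncard : ENNReal) * c = 1 := by
    rw [← hS, MeasureTheory.measure_univ]
  have hne : (Set.univ : Set (SimpleGraph (Fin n))).ncard ≠ 0 := by
    intro h
    simp [h] at h1
  rw [hS, ENNReal.ofReal_div_of_pos (by positivity), ENNReal.ofReal_natCast, ENNReal.ofReal_natCast,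
    ENNReal.eq_div_iff (by exact_mod_cast hne) (ENNReal.natCast_ne_top _), mul_left_comm, h1,
    mul_one]

/-- The union bound over all pairs of vertices. -/
theorem ncard_not_injective_walkRow_le {n q : ℕ} (hq : 0 < q) (hn : 256 * q + 2 ≤ n) :
    ({G : SimpleGraph (Fin n) | ¬ Function.Injective (walkRow G)}.ncard : ℝ) ≤
      n ^ 2 * (3 * (3 / 4) ^ q + 2 * ((q : ℝ)⁻¹ * ((q : ℝ)⁻¹ * (√q)⁻¹))) *
        (Set.univ : Set (SimpleGraph (Fin n))).ncard := by
  classical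
  set ε : ℝ := 3 * (3 / 4) ^ q + 2 * ((q : ℝ)⁻¹ * ((q : ℝ)⁻¹ * (√q)⁻¹)) with hε
  have hsub : {G : SimpleGraph (Fin n) | ¬ Function.Injective (walkRow G)} ⊆
      ⋃ p ∈ (Finset.univ : Finset (Fin n)).offDiag, {G : SimpleGraph (Fin n) |
        G.gap p.1 p.2 (fun _ => 1) = 0 ∧ G.gap p.1 p.2 G.degZ = 0 ∧ G.walkGap p.1 p.2 = 0} := by
    intro G hG
    simp only [Function.Injective, not_forall, Set.mem_ofPred_eq] at hG
    obtain ⟨x, y, hxy, hne⟩ := hG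
    rw [Set.mem_iUnion₂]
    exact ⟨(x, y), by simpa using hne, gap_eq_zero_of_walkRow_eq hxy⟩
  have h1 : ({G : SimpleGraph (Fin n) | ¬ Function.Injective (walkRow G)}.ncard : ℝ) ≤
      ∑ p ∈ (Finset.univ : Finset (Fin n)).offDiag, ({G : SimpleGraph (Fin n) |
        G.gap p.1 p.2 (fun _ => 1) = 0 ∧ G.gap p.1 p.2 G.degZ = 0 ∧
          G.walkGap p.1 p.2 = 0}.ncard : ℝ) := by
    exact_mod_cast (Set.ncard_le_ncard hsub (Set.toFinite _)).trans
      (Finset.set_ncard_biUnion_le _ _)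
  refine h1.trans ((Finset.sum_le_sum fun p hp => SimpleGraph.ncard_coincidence
    (Finset.mem_offDiag.1 hp).2.2 hq (by simpa using hn)).trans ?_)
  rw [Finset.sum_const, nsmul_eq_mul, mul_assoc]
  refine mul_le_mul_of_nonneg_right ?_ (by positivity)
  have h2 : (Finset.univ : Finset (Fin n)).offDiag.card ≤ n ^ 2 := by
    rw [Finset.offDiag_card, Finset.card_univ, Fintype.card_fin, sq]
    exact Nat.sub_le _ _
  exact_mod_cast h2

open Filter Topology in
theorem tendsto_injective_walkRow :
    Tendsto (fun n : ℕ => SimpleGraph.binomialRandom (Fin n) edgeProb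
      {G : SimpleGraph (Fin n) | Function.Injective (walkRow G)}) atTop (𝓝 1) := by
  have hε : Tendsto (fun q : ℕ => (514 : ℝ) ^ 2 *
      (3 * ((q : ℝ) ^ 2 * (3 / 4) ^ q) + 2 * (√q)⁻¹)) atTop (𝓝 0) := by
    have h1 : Tendsto (fun q : ℕ => (q : ℝ) ^ 2 * (3 / 4) ^ q) atTop (𝓝 0) :=
      tendsto_pow_const_mul_const_pow_of_abs_lt_one 2 (by rw [abs_lt]; norm_num)
    have h2 : Tendsto (fun q : ℕ => (√(q : ℝ))⁻¹) atTop (𝓝 0) :=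
      tendsto_inv_atTop_zero.comp (Real.tendsto_sqrt_atTop.comp tendsto_natCast_atTop_atTop)
    simpa using ((h1.const_mul 3).add (h2.const_mul 2)).const_mul ((514 : ℝ) ^ 2)
  have hq : Tendsto (fun n : ℕ => (n - 2) / 256) atTop atTop :=
    (Nat.tendsto_div_const_atTop (by norm_num)).comp (tendsto_sub_atTop_nat 2)
  have hbad := ENNReal.tendsto_ofReal (hε.comp hq)
  rw [ENNReal.ofReal_zero] at hbad
  have hlow := ENNReal.Tendsto.sub (tendsto_const_nhds (x := (1 : ENNReal))) hbad (by simp)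
  rw [tsub_zero] at hlow
  refine tendsto_of_tendsto_of_tendsto_of_le_of_le' hlow tendsto_const_nhds ?_
    (Eventually.of_forall fun n => MeasureTheory.prob_le_one)
  filter_upwards [eventually_ge_atTop 258] with n hn
  have hcompl : {G : SimpleGraph (Fin n) | Function.Injective (walkRow G)} =
      {G : SimpleGraph (Fin n) | ¬ Function.Injective (walkRow G)}ᶜ := by ext; simp
  rw [hcompl, MeasureTheory.prob_compl_eq_one_sub (Set.toFinite _).measurableSet]
  refine tsub_le_tsub_left ?_ 1
  rw [binomialRandom_edgeProb_apply]
  refine ENNReal.ofReal_le_ofReal ?_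
  simp only [Function.comp_apply]
  set q := (n - 2) / 256 with hqdef
  have hq0 : 0 < q := by omega
  have hq1 : (0 : ℝ) < q := by exact_mod_cast hq0
  have hs : (0 : ℝ) < √q := Real.sqrt_pos.2 hq1
  have hn514 : (n : ℝ) ≤ 514 * q := by exact_mod_cast (by omega : n ≤ 514 * q)
  refine div_le_of_le_mul₀ (Nat.cast_nonneg _) (by positivity) ?_
  refine (ncard_not_injective_walkRow_le hq0 (by omega)).trans
    (mul_le_mul_of_nonneg_right ?_ (Nat.cast_nonneg _))
  calc (n : ℝ) ^ 2 * (3 * (3 / 4) ^ q + 2 * ((q : ℝ)⁻¹ * ((q : ℝ)⁻¹ * (√q)⁻¹)))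
      ≤ (514 * q) ^ 2 * (3 * (3 / 4) ^ q + 2 * ((q : ℝ)⁻¹ * ((q : ℝ)⁻¹ * (√q)⁻¹))) := by gcongr
    _ = 514 ^ 2 * (3 * ((q : ℝ) ^ 2 * (3 / 4) ^ q) + 2 * (√q)⁻¹) := by field_simp

namespace RAM

/-! ### Cost accounting -/

theorem bitLen_mono {a b : ℕ} (h : a ≤ b) : bitLen a ≤ bitLen b :=
  Nat.add_le_add_right (Nat.log_mono_right h) 1

theorem bitLen_le_mulBits (a : ℕ) : bitLen a ≤ mulBits a a := by
  simp only [mulBits, max_self]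
  exact Nat.le_mul_of_pos_right _ (Nat.succ_pos _)

theorem mulBits_mono {a b B : ℕ} (ha : a ≤ B) (hb : b ≤ B) : mulBits a b ≤ mulBits B B := by
  have h : max (bitLen a) (bitLen b) ≤ max (bitLen B) (bitLen B) :=
    max_le_max (bitLen_mono ha) (bitLen_mono hb)
  exact Nat.mul_le_mul h (Nat.add_le_add_right (Nat.log_mono_right h) 1)

/-- A bound for the bit cost of a single operation on numbers of size at most `B`. -/
def opBits (B : ℕ) : ℕ := 2 * mulBits B B

theorem bitLen_le_opBits {a B : ℕ} (h : a ≤ B) : bitLen a ≤ opBits B := by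
  have := (bitLen_mono h).trans (bitLen_le_mulBits B)
  unfold opBits
  omega

theorem bitLen_add_bitLen_le_opBits {a b B : ℕ} (ha : a ≤ B) (hb : b ≤ B) :
    bitLen a + bitLen b ≤ opBits B := by
  have h1 := (bitLen_mono ha).trans (bitLen_le_mulBits B)
  have h2 := (bitLen_mono hb).trans (bitLen_le_mulBits B)
  unfold opBits
  omega

/-- All numbers and addresses that occur in the evaluation of an expression are at most `B`. -/
def Expr.Within (B : ℕ) (s : State) : Expr → Prop
  | const c => c ≤ B
  | reg r => s.reg r ≤ B
  | read b i => i.Within B s ∧ i.val s ≤ B ∧ s.arr b (i.val s) ≤ B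
  | add e f => e.Within B s ∧ f.Within B s ∧ e.val s + f.val s ≤ B
  | mul e f => e.Within B s ∧ f.Within B s ∧ e.val s * f.val s ≤ B

/-- The number of operations in an expression. -/
def Expr.ops : Expr → ℕ
  | const _ => 1
  | reg _ => 1
  | read _ i => i.ops + 1
  | add e f => e.ops + f.ops + 1
  | mul e f => e.ops + f.ops + 1

theorem Expr.Within.val_le {B : ℕ} {s : State} {e : Expr} (h : e.Within B s) : e.val s ≤ B := by
  cases e with
  | const c => exact h
  | reg r => exact h
  | read b i => exact h.2.2
  | add e f => exact h.2.2
  | mul e f => exact h.2.2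

/-- A cost of at most `k` operations on numbers of size at most `B`. -/
def CostLE (B k : ℕ) (c : ℕ × ℕ) : Prop := c.1 ≤ k ∧ c.2 ≤ k * opBits B

theorem CostLE.add {B k l : ℕ} {c d : ℕ × ℕ} (hc : CostLE B k c) (hd : CostLE B l d) :
    CostLE B (k + l) (c + d) :=
  ⟨Nat.add_le_add hc.1 hd.1, by rw [Nat.add_mul]; exact Nat.add_le_add hc.2 hd.2⟩

theorem CostLE.mono {B k l : ℕ} {c : ℕ × ℕ} (hc : CostLE B k c) (h : k ≤ l) : CostLE B l c :=
  ⟨hc.1.trans h, hc.2.trans (Nat.mul_le_mul_right _ h)⟩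

theorem costLE_one {B b : ℕ} (h : b ≤ opBits B) : CostLE B 1 (1, b) :=
  ⟨le_rfl, by simpa using h⟩

theorem Expr.Within.costLE {B : ℕ} {s : State} {e : Expr} (h : e.Within B s) :
    CostLE B e.ops (e.cost s) := by
  induction e with
  | const c => exact costLE_one (bitLen_le_opBits h)
  | reg r => exact costLE_one (bitLen_le_opBits h)
  | read b i ih => exact (ih h.1).add (costLE_one (bitLen_add_bitLen_le_opBits h.2.1 h.2.2))
  | add e f ihe ihf =>
    exact ((ihe h.1).add (ihf h.2.1)).add
      (costLE_one (bitLen_add_bitLen_le_opBits h.1.val_le h.2.1.val_le))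
  | mul e f ihe ihf =>
    refine ((ihe h.1).add (ihf h.2.1)).add (costLE_one ?_)
    have := mulBits_mono h.1.val_le h.2.1.val_le
    unfold opBits
    omega

/-- All numbers and addresses that occur in a test are at most `B`. -/
def Test.Within (B : ℕ) (s : State) : Test → Prop
  | lt e f => e.Within B s ∧ f.Within B s
  | eq e f => e.Within B s ∧ f.Within B s

/-- The number of operations in a test. -/
def Test.ops : Test → ℕ
  | lt e f => e.ops + f.ops + 1
  | eq e f => e.ops + f.ops + 1

theorem Test.Within.costLE {B : ℕ} {s : State} {t : Test} (h : t.Within B s) :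
    CostLE B t.ops (t.cost s) := by
  cases t with
  | lt e f =>
    exact (h.1.costLE.add h.2.costLE).add
      (costLE_one (bitLen_add_bitLen_le_opBits h.1.val_le h.2.val_le))
  | eq e f =>
    exact (h.1.costLE.add h.2.costLE).add
      (costLE_one (bitLen_add_bitLen_le_opBits h.1.val_le h.2.val_le))

/-! ### Total correctness with cost bounds -/

/-- Started in the state `s`, the program `p` halts after at most `k` operations on numbers of size
at most `B`, in a state that satisfies `Q`. -/
def Halts (B : ℕ) (p : Prog) (s : State) (k : ℕ) (Q : State → Prop) : Prop :=
  ∃ s' c, Exec p s s' c ∧ CostLE B k c ∧ Q s'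

namespace Halts

variable {B k l : ℕ} {s : State} {p q : Prog} {Q R : State → Prop} {t : Test}

theorem mono (h : Halts B p s k Q) (hkl : k ≤ l) (hQR : ∀ s, Q s → R s) : Halts B p s l R := by
  obtain ⟨s', c, h1, h2, h3⟩ := h
  exact ⟨s', c, h1, h2.mono hkl, hQR _ h3⟩

theorem skip (h : Q s) : Halts B .skip s 1 Q :=
  ⟨s, _, .skip s, costLE_one (bitLen_le_opBits (a := 0) (Nat.zero_le _)), h⟩

theorem assign {r : Reg} {e : Expr} (he : e.Within B s) (h : Q (s.setReg r (e.val s))) :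
    Halts B (.assign r e) s (e.ops + 1) Q :=
  ⟨_, _, .assign r e s, he.costLE.add (costLE_one (bitLen_le_opBits he.val_le)), h⟩

theorem store {b : Arr} {i e : Expr} (hi : i.Within B s) (he : e.Within B s)
    (h : Q (s.setArr b (i.val s) (e.val s))) :
    Halts B (.store b i e) s (i.ops + e.ops + 1) Q :=
  ⟨_, _, .store b i e s, (hi.costLE.add he.costLE).add
    (costLE_one (bitLen_add_bitLen_le_opBits hi.val_le he.val_le)), h⟩

theorem seq (h : Halts B p s k fun s' => Halts B q s' l Q) : Halts B (.seq p q) s (k + l) Q := by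
  obtain ⟨s', c, h1, h2, s'', d, h3, h4, h5⟩ := h
  exact ⟨s'', _, .seq p q s s' s'' c d h1 h3, h2.add h4, h5⟩

theorem ite (ht : t.Within B s) (h₁ : t.holds s → Halts B p s k Q)
    (h₂ : ¬ t.holds s → Halts B q s k Q) : Halts B (.ite t p q) s (t.ops + k) Q := by
  by_cases h : t.holds s
  · obtain ⟨s', c, h3, h4, h5⟩ := h₁ h
    exact ⟨s', _, .ite_true t p q s s' c h h3, ht.costLE.add h4, h5⟩
  · obtain ⟨s', c, h3, h4, h5⟩ := h₂ h
    exact ⟨s', _, .ite_false t p q s s' c h h3, ht.costLE.add h4, h5⟩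

/-- The rule for bounded loops; `I i` is the invariant at the start of round `i`. -/
theorem forAll {r : Reg} {n : ℕ} (I : ℕ → State → Prop) (hn : n ≤ B) (hB : 1 ≤ B)
    (hI : ∀ i s, I i s → s.reg r = i ∧ s.reg .size = n) (h0 : I 0 (s.setReg r 0))
    (hstep : ∀ i < n, ∀ s, I i s →
      Halts B p s k fun s' => s'.reg r = i ∧ I (i + 1) (s'.setReg r (i + 1))) :
    Halts B (forAll r p) s (n * (k + 7) + 5) (I n) := by
  have loop : ∀ m i s, i + m = n → I i s →
      Halts B (.while (.lt (.reg r) (.reg .size))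
        (.seq p (.assign r (.add (.reg r) (.const 1))))) s (m * (k + 7) + 3) (I n) := by
    intro m
    induction m with
    | zero =>
      intro i s him hs
      obtain ⟨h1, h2⟩ := hI i s hs
      have ht : (Test.lt (.reg r) (.reg .size)).Within B s := by
        simp only [Test.Within, Expr.Within]
        omega
      refine ⟨s, _, .while_false _ _ s ?_, ht.costLE.mono ?_, ?_⟩
      · simp only [Test.holds, Expr.val]
        omega
      · simp [Test.ops, Expr.ops]
      · rwa [show n = i by omega]
    | succ m ih =>
      intro i s him hs
      obtain ⟨h1, h2⟩ := hI i s hs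
      have ht : (Test.lt (.reg r) (.reg .size)).Within B s := by
        simp only [Test.Within, Expr.Within]
        omega
      have hbody : Halts B (.seq p (.assign r (.add (.reg r) (.const 1)))) s (k + 4)
          (I (i + 1)) := by
        refine seq ((hstep i (by omega) s hs).mono le_rfl fun s' hs' => ?_)
        refine (assign (e := .add (.reg r) (.const 1)) ?_ ?_).mono le_rfl fun _ h => h
        · simp only [Expr.Within, Expr.val]
          omega
        · simp only [Expr.val, hs'.1]
          exact hs'.2
      obtain ⟨s', c, h3, h4, h5⟩ := hbody
      obtain ⟨s'', d, h6, h7, h8⟩ := ih (i + 1) s' (by omega) h5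
      refine ⟨s'', _, .while_true _ _ s s' s'' c d ?_ h3 h6,
        ((ht.costLE.add h4).add h7).mono ?_, h8⟩
      · simp only [Test.holds, Expr.val]
        omega
      · simp only [Test.ops, Expr.ops]
        nlinarith
  refine (seq (k := 2) (l := n * (k + 7) + 3) ?_).mono (by omega) fun _ h => h
  exact assign (e := .const 0) (Nat.zero_le B) (loop n 0 _ (by omega) h0)

end Halts

@[simp] theorem State.setReg_reg (s : State) (r : Reg) (a : ℕ) (r' : Reg) :
    (s.setReg r a).reg r' = if r' = r then a else s.reg r' := Function.update_apply ..

@[simp] theorem State.setReg_arr (s : State) (r : Reg) (a : ℕ) : (s.setReg r a).arr = s.arr := rfl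

@[simp] theorem State.setArr_reg (s : State) (b : Arr) (i a : ℕ) :
    (s.setArr b i a).reg = s.reg := rfl

theorem State.setArr_arr_of_ne (s : State) {b b' : Arr} (i a : ℕ) (h : b' ≠ b) :
    (s.setArr b i a).arr b' = s.arr b' := Function.update_of_ne h ..

@[simp] theorem State.setArr_arr_self (s : State) (b : Arr) (i a j : ℕ) :
    (s.setArr b i a).arr b j = if j = i then a else s.arr b j := by
  simp [State.setArr, Function.update_apply]

end RAM

namespace AlgorithmA

open RAM

/-! ### The parts of the algorithm -/

/-- For each `x`, sum the values of `e` over all `y` and store the result in `dst`. Both `degrees`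
and `mulVec` are of this form by definition. -/
def rowSums (e : Expr) (dst : Arr) : Prog :=
  forAll .x
    (.seq (.assign .acc (.const 0))
    (.seq (forAll .y (.assign .acc (.add (.reg .acc) e)))
          (.store dst (.reg .x) (.reg .acc))))

/-- The expression `e` is allowed to read every array except `dst`, which is being overwritten. -/
theorem halts_rowSums {B n : ℕ} {s₀ : State} {e : Expr} {dst : Arr} {g : ℕ → ℕ → ℕ}
    (hB : 1 ≤ B) (hn : n ≤ B) (hsize : s₀.reg .size = n)
    (he : ∀ s : State, s.reg .size = n → s.reg .x < n → s.reg .y < n →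
      (∀ b ≠ dst, s.arr b = s₀.arr b) → e.Within B s ∧ e.val s = g (s.reg .x) (s.reg .y))
    (hg : ∀ i < n, ∑ j ∈ Finset.range n, g i j ≤ B) :
    Halts B (rowSums e dst) s₀ (n * (n * (e.ops + 10) + 17) + 5) fun s =>
      s.reg .size = n ∧ s.reg .success = s₀.reg .success ∧ (∀ b ≠ dst, s.arr b = s₀.arr b) ∧
        ∀ i < n, s.arr dst i = ∑ j ∈ Finset.range n, g i j := by
  refine (Halts.forAll (k := n * (e.ops + 10) + 10) (fun i s => s.reg .x = i ∧ s.reg .size = n ∧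
    s.reg .success = s₀.reg .success ∧ (∀ b ≠ dst, s.arr b = s₀.arr b) ∧
    ∀ a < i, s.arr dst a = ∑ j ∈ Finset.range n, g a j) hn hB (fun i s h => ⟨h.1, h.2.1⟩)
    (by simp [hsize]) ?_).mono (Nat.le_of_eq (by ring)) fun s h => h.2
  rintro i hi s ⟨hx, hs, hsucc, hother, hdst⟩
  refine (Halts.seq (k := 2) (l := n * (e.ops + 10) + 5 + 3) (Halts.assign (e := .const 0)
    (Nat.zero_le B) (Halts.seq (Halts.mono (Halts.forAll (n := n) (k := e.ops + 3)
    (fun j s => s.reg .y = j ∧ s.reg .size = n ∧ s.reg .x = i ∧ s.reg .success = s₀.reg .success ∧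
      s.reg .acc = ∑ j' ∈ Finset.range j, g i j' ∧ (∀ b ≠ dst, s.arr b = s₀.arr b) ∧
      ∀ a < i, s.arr dst a = ∑ j ∈ Finset.range n, g a j)
    hn hB (fun i s h => ⟨h.1, h.2.1⟩) ?_ ?_) le_rfl ?_)))).mono (by omega) fun _ h => h
  · simp [hx, hs, hsucc, Expr.val]
    exact ⟨hother, hdst⟩
  · rintro j hj s ⟨hy, hs, hx, hsucc, hacc, hother, hdst⟩
    obtain ⟨hW, hv⟩ := he s hs (by omega) (by omega) hother
    rw [hx, hy] at hv
    have hle : ∑ j' ∈ Finset.range (j + 1), g i j' ≤ B :=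
      (Finset.sum_le_sum_of_subset (Finset.range_subset_range.2 hj)).trans (hg i hi)
    rw [Finset.sum_range_succ] at hle
    refine (Halts.assign (e := .add (.reg .acc) e) ?_ ?_).mono ?_ fun _ h => h
    · simp only [Expr.Within, Expr.val, hv, hacc]
      exact ⟨by omega, hW, hle⟩
    · simp [hx, hy, hs, hsucc, Expr.val, hv, hacc, Finset.sum_range_succ]
      exact ⟨hother, hdst⟩
    · simp only [Expr.ops]
      omega
  · rintro s ⟨hy, hs, hx, hsucc, hacc, hother, hdst⟩
    refine Halts.store (i := .reg .x) (e := .reg .acc) ?_ ?_ ?_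
    · simp only [Expr.Within]
      omega
    · simp only [Expr.Within, hacc]
      exact hg i hi
    · refine ⟨by simp [hx], by simp, by simp [hs], by simp [hsucc], fun b hb => ?_, fun a ha => ?_⟩
      · rw [State.setReg_arr, State.setArr_arr_of_ne _ _ _ hb, hother b hb]
      · rw [State.setReg_arr, State.setArr_arr_self]
        simp only [Expr.val, hx, hacc]
        split_ifs with h
        · rw [h]
        · exact hdst a (by omega)

/-- The rows `a` and `b` of the matrix with the columns `D1`, `D2`, `D3` agree. -/
def SameRow (s : State) (a b : ℕ) : Prop :=
  s.arr .D1 a = s.arr .D1 b ∧ s.arr .D2 a = s.arr .D2 b ∧ s.arr .D3 a = s.arr .D3 b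

theorem halts_findDuplicates {B n : ℕ} {s₀ : State} (hB : 1 ≤ B) (hn : n ≤ B)
    (hsize : s₀.reg .size = n) (h1 : ∀ i < n, s₀.arr .D1 i ≤ B) (h2 : ∀ i < n, s₀.arr .D2 i ≤ B)
    (h3 : ∀ i < n, s₀.arr .D3 i ≤ B) :
    Halts B findDuplicates s₀ (n * (n * 30 + 12) + 7) fun s =>
      s.reg .size = n ∧ s.reg .success = s₀.reg .success ∧ s.arr = s₀.arr ∧
        s.reg .dup ≤ 1 ∧ (s.reg .dup = 0 ↔ ∀ a < n, ∀ b < n, a < b → ¬ SameRow s₀ a b) := by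
  refine (Halts.seq (k := 2) (l := n * (n * 30 + 5 + 7) + 5) (Halts.assign (e := .const 0)
    (Nat.zero_le B) ((Halts.forAll (n := n) (fun i s => s.reg .x = i ∧ s.reg .size = n ∧
    s.reg .success = s₀.reg .success ∧ s.arr = s₀.arr ∧ s.reg .dup ≤ 1 ∧
    (s.reg .dup = 0 ↔ ∀ a < i, ∀ b < n, a < b → ¬ SameRow s₀ a b)) hn hB
    (fun i s h => ⟨h.1, h.2.1⟩) (by simp [hsize, Expr.val]) ?_).mono le_rfl fun s h => h.2))).mono
    (Nat.le_of_eq (by ring)) fun s h => h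
  rintro i hi s ⟨hx, hs, hsucc, harr, hdup, hiff⟩
  refine (Halts.forAll (n := n) (k := 23) (fun j s => s.reg .y = j ∧ s.reg .size = n ∧
    s.reg .x = i ∧ s.reg .success = s₀.reg .success ∧ s.arr = s₀.arr ∧ s.reg .dup ≤ 1 ∧
    (s.reg .dup = 0 ↔ (∀ a < i, ∀ b < n, a < b → ¬ SameRow s₀ a b) ∧
      ∀ b < j, i < b → ¬ SameRow s₀ i b)) hn hB
    (fun i s h => ⟨h.1, h.2.1⟩) (by simp [hs, hx, hsucc, harr, hdup, hiff]) ?_).mono le_rfl ?_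
  · rintro j hj s ⟨hy, hs, hx, hsucc, harr, hdup, hiff⟩
    have hsame : ∀ b : Arr, (∀ i < n, s₀.arr b i ≤ B) → (sameEntry b).Within B s := by
      intro b hb
      simp only [sameEntry, Test.Within, Expr.Within, Expr.val, harr, hx, hy]
      have := hb i hi
      have := hb j hj
      omega
    have hkeep : ¬ (i < j ∧ SameRow s₀ i j) → (s.reg .y = j ∧ (s.setReg .y (j + 1)).reg .y = j + 1 ∧
        (s.setReg .y (j + 1)).reg .size = n ∧ (s.setReg .y (j + 1)).reg .x = i ∧
        (s.setReg .y (j + 1)).reg .success = s₀.reg .success ∧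
        (s.setReg .y (j + 1)).arr = s₀.arr ∧ (s.setReg .y (j + 1)).reg .dup ≤ 1 ∧
        ((s.setReg .y (j + 1)).reg .dup = 0 ↔ (∀ a < i, ∀ b < n, a < b → ¬ SameRow s₀ a b) ∧
          ∀ b < j + 1, i < b → ¬ SameRow s₀ i b)) := by
      intro hns
      refine ⟨hy, by simp, by simp [hs], by simp [hx], by simp [hsucc], by simp [harr],
        by simp [hdup], ?_⟩
      simp only [State.setReg_reg, reduceCtorEq, if_false]
      rw [hiff, Nat.forall_lt_succ_right]
      tauto
    have hD : ∀ b : Arr, (sameEntry b).holds s ↔ s₀.arr b i = s₀.arr b j := by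
      intro b
      simp [sameEntry, Test.holds, Expr.val, harr, hx, hy]
    refine (Halts.ite (k := 5 + (5 + (5 + 2))) ?_ (fun c0 => Halts.ite (t := sameEntry .D1)
      (hsame _ h1) (fun c1 => Halts.ite (t := sameEntry .D2) (hsame _ h2)
      (fun c2 => Halts.ite (t := sameEntry .D3) (hsame _ h3) (fun c3 => ?_) fun c3 => ?_)
      fun c2 => ?_) fun c1 => ?_) fun c0 => ?_).mono (by simp [Test.ops, Expr.ops]) fun _ h => h
    · simp only [Test.Within, Expr.Within]
      omega
    · simp only [Test.holds, Expr.val, hx, hy] at c0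
      rw [hD] at c1 c2 c3
      refine Halts.assign (e := .const 1) hB ?_
      refine ⟨by simp [hy], by simp, by simp [hs], by simp [hx], by simp [hsucc], by simp [harr],
        by simp [Expr.val], ?_⟩
      simp only [State.setReg_reg, reduceCtorEq, if_false, if_true, Expr.val]
      -- Both sides are false: `dup` has become `1`, and the rows `i` and `j` agree.
      refine ⟨fun h => absurd h (by simp), fun h => ?_⟩
      exact absurd ⟨c1, c2, c3⟩ (h.2 j (Nat.lt_succ_self j) c0)
    · rw [hD] at c3
      exact (Halts.skip (hkeep fun h => c3 h.2.2.2)).mono (by omega) fun _ h => h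
    · rw [hD] at c2
      exact (Halts.skip (hkeep fun h => c2 h.2.2.1)).mono (by omega) fun _ h => h
    · rw [hD] at c1
      exact (Halts.skip (hkeep fun h => c1 h.2.1)).mono (by omega) fun _ h => h
    · simp only [Test.holds, Expr.val, hx, hy] at c0
      exact (Halts.skip (hkeep fun h => c0 h.1)).mono (by omega) fun _ h => h
  · rintro s ⟨hy, hs, hx, hsucc, harr, hdup, hiff⟩
    refine ⟨hx, by simp, by simp [hs], by simp [hsucc], by simp [harr], by simp [hdup], ?_⟩
    simp only [State.setReg_reg, reduceCtorEq, if_false]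
    rw [hiff, Nat.forall_lt_succ_right]

theorem halts_writeLabels {B n : ℕ} {s₀ : State} (hB : 3 * n + 3 ≤ B)
    (hsize : s₀.reg .size = n) (h1 : ∀ i < n, s₀.arr .D1 i ≤ B) (h2 : ∀ i < n, s₀.arr .D2 i ≤ B)
    (h3 : ∀ i < n, s₀.arr .D3 i ≤ B) :
    Halts B writeLabels s₀ (n * 29 + 7) fun s => s.reg .success = 1 ∧ ∀ i < n,
      s.arr .label (3 * i) = s₀.arr .D1 i ∧ s.arr .label (3 * i + 1) = s₀.arr .D2 i ∧
        s.arr .label (3 * i + 2) = s₀.arr .D3 i := by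
  refine Halts.seq (k := n * (22 + 7) + 5) (l := 2) ((Halts.forAll (n := n)
    (fun i s => s.reg .x = i ∧ s.reg .size = n ∧ (∀ b ≠ .label, s.arr b = s₀.arr b) ∧
    ∀ a < i, s.arr .label (3 * a) = s₀.arr .D1 a ∧ s.arr .label (3 * a + 1) = s₀.arr .D2 a ∧
        s.arr .label (3 * a + 2) = s₀.arr .D3 a) (by omega) (by omega)
    (fun i s h => ⟨h.1, h.2.1⟩) (by simp [hsize]) ?_).mono le_rfl
    fun s h => Halts.assign (e := .const 1) ?_ ?_)
  · rintro i hi s ⟨hx, hs, harr, hlab⟩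
    have b1 := h1 i hi
    have b2 := h2 i hi
    have b3 := h3 i hi
    have e1 := harr .D1 (by simp)
    have e2 := harr .D2 (by simp)
    have e3 := harr .D3 (by simp)
    refine (Halts.seq (k := 6) (l := 8 + 8) (Halts.store ?_ ?_ (Halts.seq
      (Halts.store ?_ ?_ (Halts.store ?_ ?_ ?_))))).mono le_rfl fun _ h => h
    · simp only [Expr.Within, Expr.val, hx]; omega
    · simp only [Expr.Within, Expr.val, hx, e1]; omega
    · simp only [Expr.Within, Expr.val, hx, State.setArr_reg]; omega
    · simp only [Expr.Within, Expr.val, hx, State.setArr_reg, e2,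
        State.setArr_arr_of_ne _ _ _ (show Arr.D2 ≠ Arr.label by simp)]
      omega
    · simp only [Expr.Within, Expr.val, hx, State.setArr_reg]; omega
    · simp only [Expr.Within, Expr.val, hx, State.setArr_reg, e3,
        State.setArr_arr_of_ne _ _ _ (show Arr.D3 ≠ Arr.label by simp)]
      omega
    · refine ⟨by simp [hx], by simp, by simp [hs], fun b hb => ?_, fun a ha => ?_⟩
      · rw [State.setReg_arr, State.setArr_arr_of_ne _ _ _ hb, State.setArr_arr_of_ne _ _ _ hb,
          State.setArr_arr_of_ne _ _ _ hb, harr b hb]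
      · simp only [State.setReg_arr, State.setArr_arr_self, Expr.val, hx, State.setArr_reg, e1, e2,
          e3, State.setArr_arr_of_ne _ _ _ (show Arr.D2 ≠ Arr.label by simp),
          State.setArr_arr_of_ne _ _ _ (show Arr.D3 ≠ Arr.label by simp)]
        rcases (Nat.lt_succ_iff_lt_or_eq.1 ha) with h | rfl
        · have := hlab a h
          refine ⟨?_, ?_, ?_⟩
          · rw [if_neg (by omega), if_neg (by omega), if_neg (by omega)]; exact this.1
          · rw [if_neg (by omega), if_neg (by omega), if_neg (by omega)]; exact this.2.1
          · rw [if_neg (by omega), if_neg (by omega), if_neg (by omega)]; exact this.2.2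
        · refine ⟨?_, ?_, ?_⟩
          · rw [if_neg (by omega), if_neg (by omega), if_pos rfl]
          · rw [if_neg (by omega), if_pos rfl]
          · rw [if_pos rfl]
  · simp only [Expr.Within]; omega
  · refine ⟨by simp [Expr.val], h.2.2.2⟩

end AlgorithmA

namespace AlgorithmA

open RAM

variable {n : ℕ}

/-! ### Correctness and running time of the algorithm -/

theorem walkVec_le (G : SimpleGraph (Fin n)) (k : ℕ) (v : Fin n) : walkVec G k v ≤ n ^ k := by
  classical
  induction k generalizing v with
  | zero => simp [walkVec_zero]
  | succ k ih =>
    rw [walkVec_succ]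
    calc ∑ z, (if G.Adj v z then 1 else 0) * walkVec G k z
        ≤ ∑ _z : Fin n, n ^ k := by
          refine Finset.sum_le_sum fun z _ => ?_
          split_ifs
          · simpa using ih z
          · simp
      _ = n ^ (k + 1) := by simp [pow_succ']

open Classical in
theorem inputState_adj (G : SimpleGraph (Fin n)) (u v : Fin n) :
    (inputState G).arr .adj (u * n + v) = if G.Adj u v then 1 else 0 := by
  have h : (∃ u' v' : Fin n, (u : ℕ) * n + v = (u' : ℕ) * n + v' ∧ G.Adj u' v') ↔ G.Adj u v := by
    constructor
    · rintro ⟨u', v', h, ha⟩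
      have hv : (v : ℕ) = v' := by
        have := congrArg (· % n) h
        simpa [Nat.mod_eq_of_lt] using this
      have hu : (u : ℕ) = u' := by
        rw [hv, Nat.add_right_cancel_iff] at h
        exact Nat.eq_of_mul_eq_mul_right v.pos h
      rwa [Fin.ext hu, Fin.ext hv]
    · exact fun ha => ⟨u, v, rfl, ha⟩
  simp only [inputState, true_and]
  exact if_congr h rfl rfl

/-- A bound for all numbers and addresses that occur in a run of the algorithm. -/
def maxNumber (n : ℕ) : ℕ := 3 * n ^ 3 + 3

theorem le_maxNumber_of_le_pow {a k : ℕ} (hn : 0 < n) (hk : k ≤ 3) (h : a ≤ n ^ k) :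
    a ≤ maxNumber n := by
  have := h.trans (Nat.pow_le_pow_right hn hk)
  unfold maxNumber
  omega

theorem le_maxNumber (n : ℕ) : 3 * n + 3 ≤ maxNumber n := by
  have := Nat.le_self_pow (n := 3) (by norm_num) n
  unfold maxNumber
  omega

theorem entry_within {G : SimpleGraph (Fin n)} {s : State} (u v : Fin n)
    (hs : s.reg .size = n) (hx : s.reg .x = u) (hy : s.reg .y = v)
    (hadj : s.arr .adj = (inputState G).arr .adj) :
    entry.Within (maxNumber n) s := by
  classical
  have hB := le_maxNumber n
  have hu := u.2
  have hv := v.2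
  have h1 : (u : ℕ) * n + v ≤ n ^ 2 := by nlinarith
  have h2 := le_maxNumber_of_le_pow u.pos (by norm_num) h1
  simp only [entry, Expr.Within, Expr.val, hs, hx, hy, hadj, inputState_adj]
  refine ⟨⟨⟨by omega, by omega, by omega⟩, by omega, h2⟩, h2, ?_⟩
  split_ifs <;> omega

open Classical in
theorem entry_val {G : SimpleGraph (Fin n)} {s : State} (u v : Fin n)
    (hs : s.reg .size = n) (hx : s.reg .x = u) (hy : s.reg .y = v)
    (hadj : s.arr .adj = (inputState G).arr .adj) :
    entry.val s = if G.Adj u v then 1 else 0 := by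
  simp only [entry, Expr.val, hs, hx, hy, hadj, inputState_adj]

open Classical in
/-- One product with the adjacency matrix turns walk counts of length `k` into those of length
`k + 1`. -/
theorem halts_rowSums_walkVec (G : SimpleGraph (Fin n)) {s₀ : State} {e : Expr} {dst : Arr} {k : ℕ}
    (hk : k < 3) (hsize : s₀.reg .size = n)
    (he : ∀ (s : State) (u v : Fin n), s.reg .size = n → s.reg .x = u → s.reg .y = v →
      (∀ b ≠ dst, s.arr b = s₀.arr b) → e.Within (maxNumber n) s ∧
        e.val s = (if G.Adj u v then 1 else 0) * walkVec G k v) :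
    Halts (maxNumber n) (rowSums e dst) s₀ (n * (n * (e.ops + 10) + 17) + 5) fun s =>
      s.reg .size = n ∧ s.reg .success = s₀.reg .success ∧ (∀ b ≠ dst, s.arr b = s₀.arr b) ∧
        ∀ u : Fin n, s.arr dst u = walkVec G (k + 1) u := by
  have hB := le_maxNumber n
  set g : ℕ → ℕ → ℕ := fun i j => if h : i < n ∧ j < n then
    (if G.Adj ⟨i, h.1⟩ ⟨j, h.2⟩ then 1 else 0) * walkVec G k ⟨j, h.2⟩ else 0 with hg
  have hsum : ∀ u : Fin n, ∑ j ∈ Finset.range n, g u j = walkVec G (k + 1) u := by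
    intro u
    rw [walkVec_succ, Finset.sum_range]
    refine Finset.sum_congr rfl fun v _ => ?_
    simp [hg]
  refine (halts_rowSums (g := g) (by omega) (by omega) hsize ?_ ?_).mono le_rfl ?_
  · intro s hs hx hy hother
    obtain ⟨h1, h2⟩ := he s ⟨_, hx⟩ ⟨_, hy⟩ hs rfl rfl hother
    refine ⟨h1, h2.trans ?_⟩
    simp only [hg]
    rw [dif_pos ⟨hx, hy⟩]
  · intro i hi
    exact (hsum ⟨i, hi⟩).trans_le
      (le_maxNumber_of_le_pow (Nat.zero_lt_of_lt hi) hk (walkVec_le G (k + 1) ⟨i, hi⟩))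
  · rintro s ⟨h1, h2, h3, h4⟩
    exact ⟨h1, h2, h3, fun u => (h4 u u.2).trans (hsum u)⟩

open Classical in
/-- The algorithm performs `O(n²)` operations on numbers of size at most
`maxNumber n`, and it outputs the rows of walk counts if they are pairwise different. -/
theorem halts_program (G : SimpleGraph (Fin n)) :
    Halts (maxNumber n) program (inputState G) (84 * n ^ 2 + 92 * n + 32) fun s =>
      output n s = if Function.Injective (walkRow G) then some (walkRow G) else none := by
  have hB := le_maxNumber n
  have hle : ∀ k ≤ 3, ∀ u : Fin n, walkVec G k u ≤ maxNumber n := fun k hk u =>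
    le_maxNumber_of_le_pow u.pos hk (walkVec_le G k u)
  have hmul : ∀ (src dst : Arr) (k : ℕ) (s₀ : State), src ≠ dst → dst ≠ .adj → k < 3 →
      s₀.reg .size = n → s₀.arr .adj = (inputState G).arr .adj →
      (∀ u : Fin n, s₀.arr src u = walkVec G k u) →
      Halts (maxNumber n) (mulVec src dst) s₀ (n * (n * 19 + 17) + 5) fun s =>
      s.reg .size = n ∧ s.reg .success = s₀.reg .success ∧ (∀ b ≠ dst, s.arr b = s₀.arr b) ∧
        ∀ u : Fin n, s.arr dst u = walkVec G (k + 1) u := by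
    intro src dst k s₀ hsd hda hk hs hadj hsrc
    refine halts_rowSums_walkVec G hk hs ?_
    intro s u v hs hx hy hother
    have ha := (hother .adj hda.symm).trans hadj
    have hval := entry_val u v hs hx hy ha
    have hv : s.arr src v = walkVec G k v := by rw [hother src hsd, hsrc]
    have hwv := hle k hk.le v
    simp only [Expr.Within, Expr.val, hval, hy, hv]
    refine ⟨⟨entry_within u v hs hx hy ha, ⟨by omega, by omega, hwv⟩, ?_⟩, trivial⟩
    split_ifs <;> omega
  refine (Halts.seq (k := n * (n * 16 + 17) + 5) (Halts.mono (halts_rowSums_walkVec G (k := 0)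
    (e := entry) (dst := .D1) (by norm_num) (by simp [inputState]) ?_) le_rfl ?_)).mono
    (l := 84 * n ^ 2 + 92 * n + 32) (k := n * (n * 16 + 17) + 5 + ((n * (n * 19 + 17) + 5) +
      ((n * (n * 19 + 17) + 5) + ((n * (n * 30 + 12) + 7) + (3 + (n * 29 + 7)))))) ?_ fun _ h => h
  · intro s u v hs hx hy hother
    have ha := hother .adj (by simp)
    refine ⟨entry_within u v hs hx hy ha, ?_⟩
    rw [entry_val u v hs hx hy ha, walkVec_zero, mul_one]
  · rintro s₁ ⟨hs₁, hsucc₁, hother₁, hD₁⟩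
    refine Halts.seq ((hmul .D1 .D2 1 s₁ (by simp) (by simp) (by norm_num) hs₁
      (hother₁ _ (by simp)) hD₁).mono le_rfl ?_)
    rintro s₂ ⟨hs₂, hsucc₂, hother₂, hD₂⟩
    refine Halts.seq ((hmul .D2 .D3 2 s₂ (by simp) (by simp) (by norm_num) hs₂
      ((hother₂ _ (by simp)).trans (hother₁ _ (by simp))) hD₂).mono le_rfl ?_)
    rintro s₃ ⟨hs₃, hsucc₃, hother₃, hD₃⟩
    have d1 : ∀ u : Fin n, s₃.arr .D1 u = walkVec G 1 u := fun u => by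
      rw [hother₃ _ (by simp), hother₂ _ (by simp), hD₁]
    have d2 : ∀ u : Fin n, s₃.arr .D2 u = walkVec G 2 u := fun u => by
      rw [hother₃ _ (by simp), hD₂]
    have hsucc₀ : s₃.reg .success = 0 := by
      rw [hsucc₃, hsucc₂, hsucc₁]
      simp [inputState]
    have l1 : ∀ i < n, s₃.arr .D1 i ≤ maxNumber n := fun i hi =>
      (d1 ⟨i, hi⟩).trans_le (hle 1 (by norm_num) _)
    have l2 : ∀ i < n, s₃.arr .D2 i ≤ maxNumber n := fun i hi =>
      (d2 ⟨i, hi⟩).trans_le (hle 2 (by norm_num) _)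
    have l3 : ∀ i < n, s₃.arr .D3 i ≤ maxNumber n := fun i hi =>
      (hD₃ ⟨i, hi⟩).trans_le (hle 3 (by norm_num) _)
    have hrow : ∀ u v : Fin n, SameRow s₃ u v ↔ walkRow G u = walkRow G v := by
      intro u v
      rw [funext_iff, Fin.forall_fin_succ, Fin.forall_fin_succ, Fin.forall_fin_succ]
      simp only [SameRow, d1, d2, hD₃, walkRow_apply]
      simp
    have hinj : (∀ a < n, ∀ b < n, a < b → ¬ SameRow s₃ a b) ↔ Function.Injective (walkRow G) := by
      constructor
      · intro h u v huv
        by_contra hne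
        rcases lt_or_gt_of_ne hne with hlt | hlt
        · exact h u u.2 v v.2 hlt ((hrow u v).2 huv)
        · exact h v v.2 u u.2 hlt ((hrow v u).2 huv.symm)
      · intro h a ha b hb hab hs
        have := h ((hrow ⟨a, ha⟩ ⟨b, hb⟩).1 hs)
        simp only [Fin.mk.injEq] at this
        omega
    refine Halts.seq ((halts_findDuplicates (by omega) (by omega) hs₃ l1 l2 l3).mono le_rfl ?_)
    rintro s₄ ⟨hs₄, hsucc₄, harr₄, hdup, hiff⟩
    rw [hinj] at hiff
    refine Halts.ite (t := .eq (.reg .dup) (.const 0)) ?_ (fun h => ?_) fun h => ?_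
    · simp only [Test.Within, Expr.Within]
      omega
    · refine (halts_writeLabels hB hs₄ (by rwa [harr₄]) (by rwa [harr₄]) (by rwa [harr₄])).mono
        le_rfl fun s hs => ?_
      rw [if_pos (hiff.1 h), output, if_pos hs.1]
      congr 1
      funext u k
      obtain ⟨q1, q2, q3⟩ := hs.2 u u.2
      rw [harr₄] at q1 q2 q3
      rw [walkRow_apply]
      fin_cases k
      · exact q1.trans (d1 u)
      · exact q2.trans (d2 u)
      · exact q3.trans (hD₃ u)
    · refine (Halts.skip ?_).mono (by omega) fun _ h => h
      rw [if_neg fun hi => h (hiff.2 hi), output, if_neg]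
      rw [hsucc₄, hsucc₀]
      norm_num
  · exact Nat.le_of_eq (by ring)

theorem canonizes_of_injective {G : SimpleGraph (Fin n)} (h : Function.Injective (walkRow G)) :
    Canonizes program G := by
  classical
  have key : ∀ H : SimpleGraph (Fin n), Function.Injective (walkRow H) →
      ∃ c, HaltsWith program H (some (walkRow H)) c := by
    intro H hH
    obtain ⟨s, c, h1, -, h3⟩ := halts_program H
    rw [if_pos hH] at h3
    exact ⟨c, s, h1, h3⟩
  refine ⟨walkRow G, h, key G h, fun H α => ⟨walkRow H, key H fun u v huv => ?_, walkRow_iso α⟩⟩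
  obtain ⟨u, rfl⟩ := α.surjective u
  obtain ⟨v, rfl⟩ := α.surjective v
  rw [walkRow_iso, walkRow_iso] at huv
  rw [h huv]

/-- Single operations on numbers of polynomial size have bit cost `O(log n log log n)`. -/
theorem exists_opBits_le : ∃ K : ℝ, 0 ≤ K ∧ ∀ n : ℕ, 3 ≤ n →
    (opBits (maxNumber n) : ℝ) ≤ K * (Real.log n * Real.log (Real.log n)) := by
  -- `log log 3 > 0` is the smallest value of `log log n`; it absorbs the additive constants.
  have hlog3 : 1 < Real.log 3 := by
    rw [Real.lt_log_iff_exp_lt (by norm_num)]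
    exact Real.exp_one_lt_d9.trans (by norm_num)
  have hδ : 0 < Real.log (Real.log 3) := Real.log_pos hlog3
  set δ := Real.log (Real.log 3)
  have h2 : 0 < Real.log 2 := Real.log_pos (by norm_num)
  have h9 : 0 < Real.log 9 := Real.log_pos (by norm_num)
  have hlog : ∀ m : ℕ, m ≠ 0 → (Nat.log 2 m : ℝ) * Real.log 2 ≤ Real.log m := by
    intro m hm
    rw [← Real.log_pow]
    refine Real.log_le_log (by positivity) ?_
    exact_mod_cast Nat.pow_log_le_self 2 hm
  refine ⟨2 * (9 * ((Real.log 9 / Real.log 2 + 1) / δ + 1 / Real.log 2)), by positivity,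
    fun n hn => ?_⟩
  have hn3 : (3 : ℝ) ≤ n := by exact_mod_cast hn
  set l := Real.log n
  have hl : Real.log 3 ≤ l := Real.log_le_log (by norm_num) hn3
  have hl0 : 0 < l := by linarith
  set ll := Real.log l
  have hll : δ ≤ ll := Real.log_le_log (by linarith) hl
  have hpow : maxNumber n ≤ n ^ 5 := by
    have h3 : 3 ^ 3 ≤ n ^ 3 := Nat.pow_le_pow_left hn 3
    have h4 : 3 ^ 2 ≤ n ^ 2 := Nat.pow_le_pow_left hn 2
    unfold maxNumber
    nlinarith
  have hL : (bitLen (maxNumber n) : ℝ) ≤ 9 * l := by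
    have h3 := hlog (maxNumber n) (by unfold maxNumber; omega)
    have h4 : Real.log (maxNumber n) ≤ 5 * l := by
      rw [← Nat.cast_ofNat (R := ℝ), ← Real.log_pow]
      refine Real.log_le_log ?_ (by exact_mod_cast hpow)
      exact_mod_cast (by unfold maxNumber; omega : 0 < maxNumber n)
    have h5 := Real.log_two_gt_d9
    have h6 : (0 : ℝ) ≤ Nat.log 2 (maxNumber n) := Nat.cast_nonneg _
    rw [bitLen]
    push_cast
    nlinarith
  have hL2 : (Nat.log 2 (bitLen (maxNumber n)) : ℝ) + 1 ≤
      ((Real.log 9 / Real.log 2 + 1) / δ + 1 / Real.log 2) * ll := by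
    have h3 := hlog (bitLen (maxNumber n)) (Nat.succ_ne_zero _)
    have h4 : Real.log (bitLen (maxNumber n)) ≤ Real.log 9 + ll := by
      rw [← Real.log_mul (by norm_num) hl0.ne']
      refine Real.log_le_log ?_ hL
      exact_mod_cast Nat.succ_pos _
    have h5 : (Nat.log 2 (bitLen (maxNumber n)) : ℝ) ≤ (Real.log 9 + ll) / Real.log 2 := by
      rw [le_div_iff₀ h2]
      exact h3.trans h4
    have h6 : Real.log 9 / Real.log 2 + 1 ≤ (Real.log 9 / Real.log 2 + 1) / δ * ll := by
      rw [div_mul_eq_mul_div, le_div_iff₀ hδ]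
      exact mul_le_mul_of_nonneg_left hll (by positivity)
    rw [add_div] at h5
    rw [add_mul, one_div_mul_eq_div]
    linarith
  have hmain : (mulBits (maxNumber n) (maxNumber n) : ℝ) ≤ (9 * l) *
      (((Real.log 9 / Real.log 2 + 1) / δ + 1 / Real.log 2) * ll) := by
    rw [mulBits, max_self]
    push_cast
    exact mul_le_mul hL hL2 (by positivity) (by positivity)
  rw [opBits]
  push_cast
  linarith

theorem exists_cost_bound : ∃ C : ℝ, ∀ (n : ℕ) (G : SimpleGraph (Fin n)),
      ∃ (L : Option (Fin n → Fin 3 → ℕ)) (c : ℕ × ℕ),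
        RAM.HaltsWith AlgorithmA.program G L c ∧
        (Function.Injective (walkRow G) → L = some (walkRow G)) ∧
        (¬ Function.Injective (walkRow G) → L = none) ∧
        (1 ≤ n → (c.1 : ℝ) ≤ C * (n : ℝ) ^ 2) ∧
        (3 ≤ n → (c.2 : ℝ) ≤
          C * ((n : ℝ) ^ 2 * Real.log (n : ℝ) * Real.log (Real.log (n : ℝ)))) := by
  classical
  obtain ⟨K, hK, hKn⟩ := exists_opBits_le
  refine ⟨300 + 300 * K, fun n G => ?_⟩
  obtain ⟨s, c, h1, ⟨h2, h3⟩, h4⟩ := halts_program G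
  have hops : ∀ n : ℕ, 1 ≤ n → 84 * n ^ 2 + 92 * n + 32 ≤ 300 * n ^ 2 := fun n hn => by nlinarith
  refine ⟨_, c, ⟨s, h1, h4⟩, fun h => if_pos h, fun h => if_neg h, fun hn => ?_, fun hn => ?_⟩
  · have h5 : (c.1 : ℝ) ≤ 300 * (n : ℝ) ^ 2 := by exact_mod_cast h2.trans (hops n hn)
    nlinarith [mul_nonneg hK (sq_nonneg (n : ℝ))]
  · have h5 : (c.2 : ℝ) ≤ 300 * (n : ℝ) ^ 2 * opBits (maxNumber n) := by
      exact_mod_cast h3.trans (Nat.mul_le_mul_right _ (hops n (by omega)))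
    have h6 : 300 * (n : ℝ) ^ 2 * opBits (maxNumber n) ≤
        300 * (n : ℝ) ^ 2 * (K * (Real.log n * Real.log (Real.log n))) :=
      mul_le_mul_of_nonneg_left (hKn n hn) (by positivity)
    have hn3 : (3 : ℝ) ≤ n := by exact_mod_cast hn
    have hlog : 1 ≤ Real.log n := by
      rw [Real.le_log_iff_exp_le (by linarith)]
      exact (Real.exp_one_lt_d9.le.trans (by norm_num)).trans hn3
    have h7 : 0 ≤ (n : ℝ) ^ 2 * Real.log n * Real.log (Real.log n) :=
      mul_nonneg (by positivity) (Real.log_nonneg hlog)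
    linarith

end AlgorithmA

theorem mainTheorem2 :
    (∀ (n : ℕ) (G : SimpleGraph (Fin n)) (v : Fin n),
      walkRow G v = ![walkCount G 1 v, walkCount G 2 v, walkCount G 3 v]) ∧
    (∃ C : ℝ, ∀ (n : ℕ) (G : SimpleGraph (Fin n)),
      ∃ (L : Option (Fin n → Fin 3 → ℕ)) (c : ℕ × ℕ),
        RAM.HaltsWith AlgorithmA.program G L c ∧
        (Function.Injective (walkRow G) → L = some (walkRow G)) ∧
        (¬ Function.Injective (walkRow G) → L = none) ∧
        (1 ≤ n → (c.1 : ℝ) ≤ C * (n : ℝ) ^ 2) ∧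
        (3 ≤ n → (c.2 : ℝ) ≤
          C * ((n : ℝ) ^ 2 * Real.log (n : ℝ) * Real.log (Real.log (n : ℝ))))) ∧
    Filter.Tendsto
      (fun n : ℕ => SimpleGraph.binomialRandom (Fin n) edgeProb
        {G : SimpleGraph (Fin n) | RAM.Canonizes AlgorithmA.program G})
      Filter.atTop (nhds 1) :=
  ⟨fun _ => walkRow_eq_walkCount, AlgorithmA.exists_cost_bound,
    tendsto_of_tendsto_of_tendsto_of_le_of_le tendsto_injective_walkRow tendsto_const_nhds
      (fun _ => MeasureTheory.measure_mono fun _ => AlgorithmA.canonizes_of_injective)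
      fun _ => MeasureTheory.prob_le_one⟩
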